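/- **Setting.** Let $(\Omega,\mathscr G,P)$ be a probability space, $L^0$ and $\bar L^0$ the real, respectively $[-\infty,\infty]$-valued, random variables modulo $P$-a.s. equality (all (in)equalities are a.s.; $\operatorname{ess\,inf}$ and $\operatorname{ess\,sup}$ are taken in the a.s. order of $\bar L^0$), $L^0_{++}=\{\lambda\in L^0:\lambda>0\}$. The ring $L^0$ carries the topology generated by the balls $\{n:|m-n|\le\varepsilon\}$, $\varepsilon\in L^0_{++}$. Conventions: $\infty-\infty=-\infty$, $0\cdot(\pm\infty)=0$. Let $\mathcal X$ be a topological $L^0$-module which contains all countable concatenations $\sum 1_{A_i}X_i$ ($(A_i)$ a countable measurable partition of $\Omega$), in which $0$ has a neighbourhood base of $L^0$-convex, $L^0$-absorbent, $L^0$-balanced, $\sigma$-stable sets (a set is $\sigma$-stable if it is closed under countable concatenations), and in which countable concatenations $\sum 1_{A_i}U_i$ of neighbourhoods of $0$ are neighbourhoods of $0$. Let $\mathcal X^*$ be the module of continuous $L^0$-linear functionals $\mathcal X\to L^0$, let $\mathcal K\subseteq\mathcal X$ be a closed $L^0$-convex cone with $0\in\mathcal K$, and let $\mathcal K^\circ=\{X^*\in\mathcal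 X^*:\langle X^*,X\rangle\ge0\ \forall X\in\mathcal K\}$, with the weak topology $L^0$-$\sigma(\mathcal X^*,\mathcal X)$. A *conditional assessment index* is a map $\alpha:\mathcal X\to\bar L^0$ that is local ($\alpha(1_AX+1_{A^c}Y)=1_A\alpha(X)+1_{A^c}\alpha(Y)$), quasiconcave ($\alpha(\lambda X+(1-\lambda)Y)\ge\alpha(X)\wedge\alpha(Y)$ for $\lambda\in L^0$, $0\le\lambda\le1$) and monotone ($\alpha(X)\ge\alpha(Y)$ if $X-Y\in\mathcal K$). Put $\mathcal A^m=\{X:\alpha(X)\ge m\}$ and $\mathcal A^{m,\circ}=\{X^*\in\mathcal X^*:\langle X^*,X\rangle\ge0\ \forall X\in\mathcal A^m\}$ for $m\in\bar L^0$. The index is *upper semicontinuous* if every $\mathcal A^m$ is closed, and *scale invariant* if $\alpha(\lambda X)=\alpha(X)$ for all $\lambda\in L^0_{++}$. For increasing $F:\bar L^0\to\bar L^0$ let $F^-(s)=\operatorname{ess\,sup}\{F(n):n<s\text{ on }\{s>-\infty\}\}$ on $\{s>-\infty\}$ and $F^-(s)=-\infty$ on $\{s=-\infty\}$; $F^+(s)=\operatorname{ess\,inf}\{F(n):n>s\text{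 on }\{s<\infty\}\}$ on $\{s<\infty\}$ and $F^+(s)=\infty$ on $\{s=\infty\}$. A *conditional minimal risk function* ($R\in\mathcal R^{\min}$) is a map $R:\mathcal K^\circ\times\bar L^0\to\bar L^0$ which (i) is jointly local; (ii) is increasing and right-continuous ($F=F^+$) in the second argument; (iii) is jointly quasiconvex with $R(\lambda X^*,s)=R(X^*,s/\lambda)$ for $\lambda\in L^0_{++}$; (iv) satisfies $\operatorname{ess\,sup}_{s\in L^0}R(X^*,s)=\operatorname{ess\,sup}_{s\in L^0}R(Y^*,s)$ for all $X^*,Y^*\in\mathcal K^\circ$; (v) has a left-continuous version $R^-$ (in the second argument) that is jointly lower semicontinuous: $\{(X^*,s)\in\mathcal K^\circ\times L^0:R^-(X^*,s)\le m\}$ is closed for every $m\in\bar L^0$. It *represents* $\alpha$ if $$\alpha(X)=\operatorname*{ess\,inf}_{X^*\in\mathcal K^\circ}R(X^*,\langle X^*,X\rangle),\qquad X\in\mathcal X .$$ **Proposition.** Let $\alpha$ be an upper semicontinuous scale-invariant conditional assessment index such that $\mathcal A^m\neq\emptyset$ for all $m\in L^0$. Define, for $X^*\in\mathcal K^\circ$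 and $s\in\bar L^0$, $$R_\alpha(X^*,s)=\begin{cases}\operatorname{ess\,inf}\{m\in\bar L^0:\ 1_{\{m<\infty\}}X^*\in\mathcal A^{m,\circ}\}&\text{on }\{s<0\},\\ +\infty&\text{on }\{s\ge0\}.\end{cases}$$ Then: 1. $R_\alpha\in\mathcal R^{\min}$ and $R_\alpha$ represents $\alpha$. 2. Every $R\in\mathcal R^{\min}$ that represents $\alpha$ satisfies $R(X^*,s)=R_\alpha(X^*,s)$ on $\{s\ge 0\}\cup\{\langle X^*,X\rangle\ne0\}\cup\{\operatorname{ess\,inf}_{Y\in\mathcal X}\alpha(Y)=-\infty\}$ for all $X^*\in\mathcal K^\circ$, $s\in\bar L^0$, $X\in\mathcal X$. That is, $R$ is uniquely determined except for its values at $X^*=0$, $s<0$ where $\alpha$ is bounded below. 3. $R_\alpha$ is the unique $R\in\mathcal R^{\min}$ that represents $\alpha$ and satisfies $R(0,s)=-\infty$ on $\{s<0\}$ for every $s\in\bar L^0$. -/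

import Mathlib

open MeasureTheory Set Filter Topology

namespace L0Risk

/-- The ring of real random variables, modulo almost sure equality. -/
abbrev L0 {Ω : Type*} [MeasurableSpace Ω] (P : Measure Ω) : Type _ := Ω →ₘ[P] ℝ

/-- The lattice of extended real random variables, modulo almost sure equality. -/
abbrev EL0 {Ω : Type*} [MeasurableSpace Ω] (P : Measure Ω) : Type _ := Ω →ₘ[P] EReal

section RandomVariables

variable {Ω : Type*} [MeasurableSpace Ω] {P : Measure Ω}

noncomputable instance : CommRing (L0 P) :=
  { (inferInstance : AddCommGroup (L0 P)), (inferInstance : CommMonoid (L0 P)) with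
    left_distrib := fun a b c => AEEqFun.ext <| by
      filter_upwards [AEEqFun.coeFn_mul a (b + c), AEEqFun.coeFn_add b c,
        AEEqFun.coeFn_add (a * b) (a * c), AEEqFun.coeFn_mul a b, AEEqFun.coeFn_mul a c]
        with x h1 h2 h3 h4 h5
      simp only [h1, h2, h3, h4, h5, Pi.mul_apply, Pi.add_apply, mul_add]
    right_distrib := fun a b c => AEEqFun.ext <| by
      filter_upwards [AEEqFun.coeFn_mul (a + b) c, AEEqFun.coeFn_add a b,
        AEEqFun.coeFn_add (a * c) (b * c), AEEqFun.coeFn_mul a c, AEEqFun.coeFn_mul b c]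
        with x h1 h2 h3 h4 h5
      simp only [h1, h2, h3, h4, h5, Pi.mul_apply, Pi.add_apply, add_mul]
    zero_mul := fun a => AEEqFun.ext <| by
      filter_upwards [AEEqFun.coeFn_mul 0 a, AEEqFun.coeFn_zero (α := Ω) (μ := P) (β := ℝ)]
        with x h1 h2
      simp only [h1, h2, Pi.mul_apply, Pi.zero_apply, zero_mul]
    mul_zero := fun a => AEEqFun.ext <| by
      filter_upwards [AEEqFun.coeFn_mul a 0, AEEqFun.coeFn_zero (α := Ω) (μ := P) (β := ℝ)]
        with x h1 h2
      simp only [h1, h2, Pi.mul_apply, Pi.zero_apply, mul_zero] }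

/-- `ε` belongs to `L⁰₊₊`: it is almost surely strictly positive. -/
def Pos (ε : L0 P) : Prop := ∀ᵐ ω ∂P, 0 < ε ω

/-- `lam` is almost surely between `0` and `1`. -/
def UnitInterval (lam : L0 P) : Prop := ∀ᵐ ω ∂P, 0 ≤ lam ω ∧ lam ω ≤ 1

/-- The topology of `L⁰` induced by the balls `{n : |m - n| ≤ ε}`, `ε ∈ L⁰₊₊`. -/
instance : TopologicalSpace (L0 P) where
  IsOpen V := ∀ m ∈ V, ∃ ε : L0 P, Pos ε ∧ ∀ n : L0 P, (∀ᵐ ω ∂P, |m ω - n ω| ≤ ε ω) → n ∈ V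
  isOpen_univ := fun _ _ => ⟨AEEqFun.const Ω 1, by
    filter_upwards [AEEqFun.coeFn_const (μ := P) Ω (1 : ℝ)] with ω h
    rw [h]; exact one_pos, fun _ _ => trivial⟩
  isOpen_inter := fun U V hU hV m hm => by
    obtain ⟨ε, hε, h1⟩ := hU m hm.1
    obtain ⟨δ, hδ, h2⟩ := hV m hm.2
    refine ⟨ε ⊓ δ, ?_, fun n hn => ⟨h1 n ?_, h2 n ?_⟩⟩
    · filter_upwards [hε, hδ, AEEqFun.coeFn_inf ε δ] with ω a b c
      rw [c]; exact lt_min a b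
    · filter_upwards [hn, AEEqFun.coeFn_inf ε δ] with ω a c
      rw [c] at a; exact a.trans inf_le_left
    · filter_upwards [hn, AEEqFun.coeFn_inf ε δ] with ω a c
      rw [c] at a; exact a.trans inf_le_right
  isOpen_sUnion := fun S hS m hm => by
    obtain ⟨V, hV, hmV⟩ := hm
    obtain ⟨ε, hε, h⟩ := hS V hV m hmV
    exact ⟨ε, hε, fun n hn => ⟨V, hV, h n hn⟩⟩

theorem mem_nhds_L0 {m : L0 P} {V : Set (L0 P)} :
    V ∈ 𝓝 m ↔ ∃ ε : L0 P, Pos ε ∧ ∀ n : L0 P, (∀ᵐ ω ∂P, |m ω - n ω| ≤ ε ω) → n ∈ V := by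
  rw [mem_nhds_iff]
  constructor
  · rintro ⟨W, hWV, hW, hm⟩
    obtain ⟨ε, hε, h⟩ := hW m hm
    exact ⟨ε, hε, fun n hn => hWV (h n hn)⟩
  · rintro ⟨ε, hε, h⟩
    refine ⟨{n | ∃ δ : L0 P, Pos δ ∧ ∀ᵐ ω ∂P, |m ω - n ω| + δ ω ≤ ε ω}, ?_, ?_, ?_⟩
    · rintro n ⟨δ, hδ, hn⟩
      refine h n ?_
      filter_upwards [hδ, hn] with ω h1 h2
      linarith
    · rintro n ⟨δ, hδ, hn⟩
      have hm : AEStronglyMeasurable (fun ω => δ ω / 2) P :=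
        (δ.measurable.div_const 2).aestronglyMeasurable
      have hpos : Pos (AEEqFun.mk _ hm : L0 P) := by
        filter_upwards [hδ, AEEqFun.coeFn_mk _ hm] with ω h1 h2
        rw [h2]; exact half_pos h1
      refine ⟨AEEqFun.mk _ hm, hpos, fun n' hn' => ⟨AEEqFun.mk _ hm, hpos, ?_⟩⟩
      filter_upwards [hn, hn', AEEqFun.coeFn_mk _ hm] with ω h1 h2 h3
      rw [h3] at h2 ⊢
      have := abs_sub_le (m ω) (n ω) (n' ω)
      linarith
    · refine ⟨ε, hε, ?_⟩
      filter_upwards with ω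
      simp

theorem ball_mem_nhds (m : L0 P) {ε : L0 P} (hε : Pos ε) :
    {n : L0 P | ∀ᵐ ω ∂P, |m ω - n ω| ≤ ε ω} ∈ 𝓝 m :=
  mem_nhds_L0.2 ⟨ε, hε, fun _ hn => hn⟩

instance : IsTopologicalRing (L0 P) where
  continuous_add := by
    rw [continuous_iff_continuousAt]
    rintro ⟨a, b⟩ V hV
    obtain ⟨ε, hε, h⟩ := mem_nhds_L0.1 hV
    have hm : AEStronglyMeasurable (fun ω => ε ω / 2) P :=
      (ε.measurable.div_const 2).aestronglyMeasurable
    have hpos : Pos (AEEqFun.mk _ hm : L0 P) := by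
      filter_upwards [hε, AEEqFun.coeFn_mk _ hm] with ω h1 h2
      rw [h2]; exact half_pos h1
    rw [mem_map]
    refine mem_of_superset (prod_mem_nhds
      (ball_mem_nhds a hpos) (ball_mem_nhds b hpos)) ?_
    rintro ⟨a', b'⟩ ⟨ha, hb⟩
    refine h _ ?_
    filter_upwards [ha, hb, AEEqFun.coeFn_mk _ hm, AEEqFun.coeFn_add a b,
      AEEqFun.coeFn_add a' b'] with ω h1 h2 h3 h4 h5
    rw [h3] at h1 h2
    simp only [h4, h5, Pi.add_apply]
    rw [abs_le] at *
    constructor <;> linarith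
  continuous_mul := by
    rw [continuous_iff_continuousAt]
    rintro ⟨a, b⟩ V hV
    obtain ⟨ε, hε, h⟩ := mem_nhds_L0.1 hV
    have hm : AEStronglyMeasurable (fun ω => min 1 (ε ω / (|a ω| + |b ω| + 1))) P := by
      have h1 := ε.measurable
      have h2 := a.measurable
      have h3 := b.measurable
      exact (measurable_const.min
        (h1.div ((h2.norm.add h3.norm).add_const 1))).aestronglyMeasurable
    have hpos : Pos (AEEqFun.mk _ hm : L0 P) := by
      filter_upwards [hε, AEEqFun.coeFn_mk _ hm] with ω h1 h2
      rw [h2]; exact lt_min one_pos (by positivity)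
    rw [mem_map]
    refine mem_of_superset (prod_mem_nhds
      (ball_mem_nhds a hpos) (ball_mem_nhds b hpos)) ?_
    rintro ⟨a', b'⟩ ⟨ha, hb⟩
    refine h _ ?_
    filter_upwards [ha, hb, AEEqFun.coeFn_mk _ hm, AEEqFun.coeFn_mul a b,
      AEEqFun.coeFn_mul a' b', hε] with ω h1 h2 h3 h4 h5 h6
    rw [h3] at h1 h2
    simp only [h4, h5, Pi.mul_apply]
    set D := |a ω| + |b ω| + 1 with hD
    have hD0 : 0 < D := by positivity
    have hb' : |b' ω| ≤ |b ω| + 1 := by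
      have e1 := h2.trans (min_le_left _ _)
      have e2 := abs_sub_abs_le_abs_sub (b' ω) (b ω)
      rw [abs_sub_comm] at e2
      linarith
    have e1 := h1.trans (min_le_right _ _)
    have e2 := h2.trans (min_le_right _ _)
    have e0 : 0 ≤ ε ω / D := by positivity
    calc |a ω * b ω - a' ω * b' ω|
        = |a ω * (b ω - b' ω) + (a ω - a' ω) * b' ω| := by ring_nf
      _ ≤ |a ω| * |b ω - b' ω| + |a ω - a' ω| * |b' ω| := by
          rw [← abs_mul, ← abs_mul]; exact abs_add_le _ _
      _ ≤ |a ω| * (ε ω / D) + (ε ω / D) * (|b ω| + 1) := by gcongr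
      _ = ε ω := by rw [hD]; field_simp; ring
  continuous_neg := by
    rw [continuous_iff_continuousAt]
    intro a V hV
    obtain ⟨ε, hε, h⟩ := mem_nhds_L0.1 hV
    refine mem_nhds_L0.2 ⟨ε, hε, fun n hn => h _ ?_⟩
    filter_upwards [hn, AEEqFun.coeFn_neg a, AEEqFun.coeFn_neg n] with ω h1 h2 h3
    rw [h2, h3, Pi.neg_apply, Pi.neg_apply, neg_sub_neg, abs_sub_comm]
    exact h1

/-- Every set of extended real random variables has a greatest lower bound for the almost sure
order. -/
theorem exists_isGLB [IsFiniteMeasure P] (S : Set (EL0 P)) : ∃ g, IsGLB S g := by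
  rcases S.eq_empty_or_nonempty with rfl | ⟨f₀, hf₀⟩
  · refine ⟨AEEqFun.const Ω ⊤, ?_⟩
    rw [isGLB_empty_iff]
    intro f
    rw [← AEEqFun.coeFn_le]
    filter_upwards [AEEqFun.coeFn_const (μ := P) Ω (⊤ : EReal)] with ω h
    rw [h]; exact le_top
  · let φ : EReal → ENNReal := fun x => (1 + x.exp)⁻¹
    have hφm : Measurable φ := by fun_prop
    have hφanti : ∀ {x y}, x ≤ y → φ y ≤ φ x := fun h =>
      ENNReal.inv_le_inv.2 (add_le_add le_rfl (EReal.exp_monotone h))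
    have hφinj : ∀ {x y}, φ x = φ y → x = y := fun {x y} h => by
      have h1 : (1 : ENNReal) + x.exp = 1 + y.exp := inv_injective h
      exact EReal.exp_strictMono.injective ((ENNReal.add_right_inj ENNReal.one_ne_top).1 h1)
    let I : (ℕ → S) → ENNReal := fun f => ∫⁻ ω, φ (⨅ n, (f n : EL0 P) ω) ∂P
    have hmeas : ∀ f : ℕ → S, Measurable fun ω => ⨅ n, (f n : EL0 P) ω := fun f =>
      Measurable.iInf fun n => (f n : EL0 P).measurable
    have : Nonempty (ℕ → S) := ⟨fun _ => ⟨f₀, hf₀⟩⟩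
    obtain ⟨u, -, hu, huI⟩ := exists_seq_tendsto_sSup (range_nonempty I) (OrderTop.bddAbove _)
    choose v hv using huI
    let F : ℕ → S := fun k => v k.unpair.1 k.unpair.2
    have hF : ∀ G : ℕ → S, I G ≤ I F := fun G => by
      refine (le_sSup (mem_range_self G)).trans (le_of_tendsto' hu fun k => ?_)
      rw [← hv k]
      refine lintegral_mono fun ω => hφanti (le_iInf fun n => ?_)
      refine (iInf_le _ (Nat.pair k n)).trans ?_
      simp [F]
    have hfin : I F ≠ ⊤ := by
      refine ne_top_of_le_ne_top (measure_ne_top P univ) ?_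
      calc I F ≤ ∫⁻ _, 1 ∂P := lintegral_mono fun ω => ENNReal.inv_le_one.2 le_self_add
        _ = P univ := lintegral_one
    refine ⟨AEEqFun.mk _ (hmeas F).aestronglyMeasurable, fun h hh => ?_, fun l hl => ?_⟩
    · let G : ℕ → S := fun n => Nat.casesOn (motive := fun _ => S) n ⟨h, hh⟩ F
      have hGF : ∀ ω, (⨅ n, (G n).1 ω) ≤ ⨅ n, (F n).1 ω := fun ω =>
        le_iInf fun n => iInf_le (fun k => (G k).1 ω) (n + 1)
      have hae := ae_eq_of_ae_le_of_lintegral_le (μ := P)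
        (Eventually.of_forall fun ω => hφanti (hGF ω)) hfin
        (hφm.comp (hmeas G)).aemeasurable (hF G)
      rw [← AEEqFun.coeFn_le]
      filter_upwards [hae, AEEqFun.coeFn_mk _ (hmeas F).aestronglyMeasurable (μ := P)]
        with ω h1 h2
      rw [h2, hφinj h1]
      exact iInf_le (fun n => (G n).1 ω) 0
    · rw [← AEEqFun.coeFn_le]
      have hall : ∀ᵐ ω ∂P, ∀ n, l ω ≤ (F n : EL0 P) ω :=
        ae_all_iff.2 fun n => AEEqFun.coeFn_le.2 (hl (F n).2)
      filter_upwards [hall, AEEqFun.coeFn_mk _ (hmeas F).aestronglyMeasurable (μ := P)]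
        with ω h1 h2
      rw [h2]; exact le_iInf h1

theorem exists_isLUB [IsFiniteMeasure P] (S : Set (EL0 P)) : ∃ g, IsLUB S g :=
  (exists_isGLB (upperBounds S)).imp fun _ h => isGLB_upperBounds.1 h

/-- The essential infimum of a set of extended real random variables (`∞` for the empty set). -/
noncomputable def essinf [IsFiniteMeasure P] (S : Set (EL0 P)) : EL0 P := (exists_isGLB S).choose

theorem isGLB_essinf [IsFiniteMeasure P] (S : Set (EL0 P)) : IsGLB S (essinf S) :=
  (exists_isGLB S).choose_spec

/-- The essential supremum of a set of extended real random variables (`-∞` for the empty set). -/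
noncomputable def esssup [IsFiniteMeasure P] (S : Set (EL0 P)) : EL0 P := (exists_isLUB S).choose

theorem isLUB_esssup [IsFiniteMeasure P] (S : Set (EL0 P)) : IsLUB S (esssup S) :=
  (exists_isLUB S).choose_spec

/-- The indicator `1_A`. -/
noncomputable def indic (P : Measure Ω) (A : Set Ω) (hA : MeasurableSet A) : L0 P :=
  AEEqFun.mk (A.indicator fun _ => 1) (measurable_const.indicator hA).aestronglyMeasurable

open Classical in
/-- `1_A f + 1_{Aᶜ} g`: the random variable equal to `f` on `A` and to `g` on `Aᶜ`. -/
noncomputable def glue {β : Type*} [TopologicalSpace β] (A : Set Ω) (hA : MeasurableSet A)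
    (f g : Ω →ₘ[P] β) : Ω →ₘ[P] β :=
  AEEqFun.mk (A.piecewise f g)
    (AEStronglyMeasurable.piecewise hA f.aestronglyMeasurable.restrict
      g.aestronglyMeasurable.restrict)

/-- The inclusion of `L⁰` into the extended random variables. -/
noncomputable def toE (s : L0 P) : EL0 P :=
  AEEqFun.comp (fun x : ℝ => (x : EReal)) continuous_coe_real_ereal s

/-- `lam * s + (1 - lam) * t`, with the conventions `∞ - ∞ = -∞` and `0 * (±∞) = 0`, which are
those of `EReal`. -/
noncomputable def mix (lam : L0 P) (s t : EL0 P) : EL0 P :=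
  AEEqFun.comp₂Measurable (fun x y : EReal => x + y) measurable_add
    (AEEqFun.comp₂Measurable (fun (x : ℝ) (y : EReal) => (x : EReal) * y)
      ((measurable_fst.coe_real_ereal).mul measurable_snd) lam s)
    (AEEqFun.comp₂Measurable (fun (x : ℝ) (y : EReal) => (x : EReal) * y)
      ((measurable_fst.coe_real_ereal).mul measurable_snd) (1 - lam) t)

/-- `s / lam`, used only for `lam ∈ L⁰₊₊`. -/
noncomputable def divE (s : EL0 P) (lam : L0 P) : EL0 P :=
  AEEqFun.comp₂Measurable (fun (x : ℝ) (y : EReal) => ((x⁻¹ : ℝ) : EReal) * y)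
    ((measurable_fst.inv.coe_real_ereal).mul measurable_snd) lam s

theorem measurableSet_lt_top (s : EL0 P) : MeasurableSet {ω | s ω < ⊤} :=
  measurableSet_lt s.measurable measurable_const

theorem measurableSet_bot_lt (s : EL0 P) : MeasurableSet {ω | ⊥ < s ω} :=
  measurableSet_lt measurable_const s.measurable

theorem measurableSet_lt_zero (s : EL0 P) : MeasurableSet {ω | s ω < 0} :=
  measurableSet_lt s.measurable measurable_const

/-- The left-continuous version `F⁻` of an increasing local function `F`:
`F⁻(s) = esssup {F(n) : n < s on {s > -∞}}` on `{s > -∞}` and `-∞` on `{s = -∞}`. -/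
noncomputable def leftVersion [IsFiniteMeasure P] (F : EL0 P → EL0 P) (s : EL0 P) : EL0 P :=
  glue {ω | ⊥ < s ω} (measurableSet_bot_lt s)
    (esssup (F '' {n | ∀ᵐ ω ∂P, ⊥ < s ω → n ω < s ω})) (AEEqFun.const Ω ⊥)

/-- The right-continuous version `F⁺` of an increasing local function `F`:
`F⁺(s) = essinf {F(n) : n > s on {s < ∞}}` on `{s < ∞}` and `∞` on `{s = ∞}`. -/
noncomputable def rightVersion [IsFiniteMeasure P] (F : EL0 P → EL0 P) (s : EL0 P) : EL0 P :=
  glue {ω | s ω < ⊤} (measurableSet_lt_top s)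
    (essinf (F '' {n | ∀ᵐ ω ∂P, s ω < ⊤ → s ω < n ω})) (AEEqFun.const Ω ⊤)

end RandomVariables

section Modules

variable {Ω : Type*} [MeasurableSpace Ω] {P : Measure Ω}

/-- A countable measurable partition of `Ω`. -/
structure IsPartition (A : ℕ → Set Ω) : Prop where
  measurable : ∀ i, MeasurableSet (A i)
  disjoint : Pairwise fun i j => Disjoint (A i) (A j)
  cover : ⋃ i, A i = univ

variable {E : Type*} [AddCommGroup E] [Module (L0 P) E]

/-- `y = ∑ 1_{A_i} x_i`, that is, `1_{A_i} y = 1_{A_i} x_i` for every `i`. -/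
def IsConcat (P : Measure Ω) {E : Type*} [AddCommGroup E] [Module (L0 P) E]
    {A : ℕ → Set Ω} (hA : IsPartition A) (x : ℕ → E) (y : E) : Prop :=
  ∀ i, indic P (A i) (hA.measurable i) • y = indic P (A i) (hA.measurable i) • x i

/-- The `σ`-stable sets: those containing `∑ 1_{A_i} x_i` whenever they contain all `x_i`. -/
def SigmaStable (P : Measure Ω) {E : Type*} [AddCommGroup E] [Module (L0 P) E]
    (C : Set E) : Prop :=
  ∀ (A : ℕ → Set Ω) (hA : IsPartition A) (x : ℕ → E) (y : E),
    (∀ i, x i ∈ C) → IsConcat P hA x y → y ∈ C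

/-- `L⁰`-convex sets. -/
def L0Convex (P : Measure Ω) {E : Type*} [AddCommGroup E] [Module (L0 P) E]
    (C : Set E) : Prop :=
  ∀ x ∈ C, ∀ y ∈ C, ∀ lam : L0 P, UnitInterval lam → lam • x + (1 - lam) • y ∈ C

/-- `L⁰`-absorbent sets. -/
def L0Absorbent (P : Measure Ω) {E : Type*} [AddCommGroup E] [Module (L0 P) E]
    (C : Set E) : Prop :=
  ∀ x : E, ∃ lam : L0 P, Pos lam ∧ ∃ u ∈ C, x = lam • u

/-- `L⁰`-balanced sets. -/
def L0Balanced (P : Measure Ω) {E : Type*} [AddCommGroup E] [Module (L0 P) E]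
    (C : Set E) : Prop :=
  ∀ x ∈ C, ∀ lam : L0 P, (∀ᵐ ω ∂P, |lam ω| ≤ 1) → lam • x ∈ C

/-- A `σ`-stable, locally `L⁰`-convex topological `L⁰`-module whose topology is `σ`-stable:
the zero neighbourhoods have a base of `L⁰`-convex, `L⁰`-absorbent, `L⁰`-balanced, `σ`-stable sets,
and countable concatenations of zero neighbourhoods are zero neighbourhoods. -/
structure IsStableLocallyConvex (P : Measure Ω) (E : Type*) [AddCommGroup E] [Module (L0 P) E]
    [TopologicalSpace E] : Prop where
  continuous_add : Continuous fun p : E × E => p.1 + p.2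
  continuous_smul : Continuous fun p : L0 P × E => p.1 • p.2
  exists_base : ∀ W ∈ 𝓝 (0 : E), ∃ U ∈ 𝓝 (0 : E), U ⊆ W ∧
    L0Convex P U ∧ L0Absorbent P U ∧ L0Balanced P U ∧ SigmaStable P U
  exists_concat : ∀ (A : ℕ → Set Ω) (hA : IsPartition A) (x : ℕ → E), ∃ y, IsConcat P hA x y
  concat_nhds : ∀ (A : ℕ → Set Ω) (hA : IsPartition A) (U : ℕ → Set E),
    (∀ i, U i ∈ 𝓝 (0 : E)) → {y | ∃ x : ℕ → E, (∀ i, x i ∈ U i) ∧ IsConcat P hA x y} ∈ 𝓝 (0 : E)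

/-- A closed `L⁰`-convex cone containing `0`. -/
structure IsClosedL0Cone (P : Measure Ω) {E : Type*} [AddCommGroup E] [Module (L0 P) E]
    [TopologicalSpace E] (K : Set E) : Prop where
  zero_mem : (0 : E) ∈ K
  convex : L0Convex P K
  smul_mem : ∀ lam : L0 P, Pos lam → ∀ x ∈ K, lam • x ∈ K
  closed : IsClosed K

/-- Conditional assessment indices: local, quasiconcave functions, monotone with respect to the
preorder `x ≽ y ↔ x - y ∈ K`. -/
structure IsAssessmentIndex (K : Set E) (α : E → EL0 P) : Prop where
  isLocal : ∀ (A : Set Ω) (hA : MeasurableSet A) (x y : E),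
    α (indic P A hA • x + indic P Aᶜ hA.compl • y) = glue A hA (α x) (α y)
  quasiconcave : ∀ (x y : E) (lam : L0 P), UnitInterval lam →
    α x ⊓ α y ≤ α (lam • x + (1 - lam) • y)
  monotone : ∀ x y : E, x - y ∈ K → α y ≤ α x

/-- Upper semicontinuity: all upper level sets are closed. -/
def IsUSC [TopologicalSpace E] (α : E → EL0 P) : Prop := ∀ m : EL0 P, IsClosed {x | m ≤ α x}

/-- Scale invariance. -/
def IsScaleInvariant (α : E → EL0 P) : Prop :=
  ∀ (lam : L0 P) (x : E), Pos lam → α (lam • x) = α x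

/-- The `L⁰`-dual: the continuous `L⁰`-linear functionals. -/
abbrev Dual (P : Measure Ω) (E : Type*) [AddCommGroup E] [Module (L0 P) E]
    [TopologicalSpace E] : Type _ := E →L[L0 P] L0 P

variable [TopologicalSpace E]

/-- The polar `{Z : ⟨Z, x⟩ ≥ 0 for all x ∈ C}` of a set. -/
def polar (P : Measure Ω) {E : Type*} [AddCommGroup E] [Module (L0 P) E] [TopologicalSpace E]
    (C : Set E) : Set (Dual P E) :=
  {Z | ∀ x ∈ C, 0 ≤ Z x}

/-- The polar of the acceptance set `{x : α x ≥ m}`. -/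
def levelPolar (α : E → EL0 P) (m : EL0 P) : Set (Dual P E) := polar P {x | m ≤ α x}

variable {K : Set E}

/-- Conditional minimal risk functions `R : K° × L̄⁰ → L̄⁰`. -/
structure IsMinimalRiskFunction [IsFiniteMeasure P] (R : polar P K → EL0 P → EL0 P) : Prop where
  jointly_local : ∀ (A : Set Ω) (hA : MeasurableSet A) (X Y Z : polar P K) (s t : EL0 P),
    (Z : Dual P E) = indic P A hA • (X : Dual P E) + indic P Aᶜ hA.compl • (Y : Dual P E) →
      R Z (glue A hA s t) = glue A hA (R X s) (R Y t)
  increasing : ∀ Z, Monotone (R Z)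
  rightContinuous : ∀ Z s, R Z s = rightVersion (R Z) s
  jointly_quasiconvex : ∀ (X Y Z : polar P K) (s t : EL0 P) (lam : L0 P), UnitInterval lam →
    (Z : Dual P E) = lam • (X : Dual P E) + (1 - lam) • (Y : Dual P E) →
      R Z (mix lam s t) ≤ R X s ⊔ R Y t
  scaling : ∀ (X Z : polar P K) (s : EL0 P) (lam : L0 P), Pos lam →
    (Z : Dual P E) = lam • (X : Dual P E) → R Z s = R X (divE s lam)
  asymptotic_max : ∀ X Y : polar P K,
    esssup (range fun s : L0 P => R X (toE s)) = esssup (range fun s : L0 P => R Y (toE s))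
  /-- `R⁻` is jointly lower semicontinuous on `K° × L⁰`, where `K°` carries the weak topology, the
  coarsest one that makes `Z ↦ ⟨Z, x⟩` continuous for every `x`. -/
  left_lsc : ∀ m : EL0 P,
    IsClosed[TopologicalSpace.induced
      (fun p : polar P K × L0 P => ((fun x : E => (p.1 : Dual P E) x), p.2))
      (inferInstance : TopologicalSpace ((E → L0 P) × L0 P))]
      {p : polar P K × L0 P | leftVersion (R p.1) (toE p.2) ≤ m}

/-- The robust representation `α x = essinf_{Z ∈ K°} R(Z, ⟨Z, x⟩)`. -/
def Represents [IsFiniteMeasure P] (R : polar P K → EL0 P → EL0 P) (α : E → EL0 P) : Prop :=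
  ∀ x, α x = essinf (range fun Z : polar P K => R Z (toE ((Z : Dual P E) x)))

/-- `essinf {m : Z ∈ 𝒜^{m,∘}}`, where membership is required only where `m < ∞`. -/
noncomputable def criticalLevel [IsFiniteMeasure P] (α : E → EL0 P) (Z : Dual P E) : EL0 P :=
  essinf {m | indic P {ω | m ω < ⊤} (measurableSet_lt_top m) • Z ∈ levelPolar α m}

/-- The risk function equal to `criticalLevel α Z` on `{s < 0}` and to `∞` on `{s ≥ 0}`. -/
noncomputable def scaleRisk [IsFiniteMeasure P] (K : Set E) (α : E → EL0 P) :
    polar P K → EL0 P → EL0 P := fun Z s =>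
  glue {ω | s ω < 0} (measurableSet_lt_zero s) (criticalLevel α (Z : Dual P E))
    (AEEqFun.const Ω ⊤)

theorem zero_mem_polar (C : Set E) : (0 : Dual P E) ∈ polar P C := fun _ _ => le_rfl

end Modules

end L0Risk

open L0Risk

/-! Write 𝒜^m for `{x | m ≤ α x}`. Scale invariance and closedness force α(0) = ∞: from x in 𝒜^n one
gets λx in 𝒜^n for every positive λ, and λ → 0 is allowed. Hence each 𝒜^m is a closed `L⁰`-convex
cone, σ-stable by locality. The critical level of Z then has the description on which everything
rests (`criticalLevel_le_on`): it is the least m with α(y) ≤ m on {⟨Z, y⟩ < 0} for every y. From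
this, the axioms for R_α are pointwise checks.

Representation. The inequality α ≤ essinf is this description. For the converse, if α(x) < q <
essinf on a set A of positive measure, then 1_A x lies outside the cone 𝒜^q. A conditional
Hahn–Banach theorem separates it by some Z in the polar of 𝒜^q; Z lies in K° because K ⊆ 𝒜^q, and
its critical level is at most q, a contradiction (`represents_scaleRisk`).

Uniqueness. Let R represent α. From R(Z, 0) ≥ α(0), R is ∞ at s ≥ 0. For s < 0 and ⟨Z, y⟩ < 0,
rescaling y so that ⟨Z, y⟩ = s gives R(Z, s) ≥ α(y), so R ≥ R_α always (`scaleRisk_le`). For the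
upper bound let C_m = {R⁻ ≤ m}. If nonempty, it is a weakly closed cone in K° × L⁰. If R(Z, s) ≤ m
failed for some s < 0, then (Z, s/2) would lie outside C_m and could be separated from it by a pair
(x, t) in E × L⁰. A multiple of x then has α ≥ m where m < ∞, and if m exceeds the critical level of
Z this makes ⟨Z, x⟩ nonnegative there and contradicts the separation
(`apply_le_of_criticalLevel_lt`). Nonemptiness of C_m requires m above essinf α. Where ⟨Z, x⟩ ≠ 0
this is automatic, since ⟨Z, x⟩ or ⟨Z, -x⟩ is negative and so essinf α is at most the critical
level. This is why only Z = 0 with α bounded below escapes.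

The separation theorem carries both halves: on E for the cones 𝒜^m, and on a finite power of `L⁰`
for C_m. -/

namespace L0Risk

/-! ### Pointwise calculus in `L⁰` and localised essential infima. -/

section Basics

variable {Ω : Type*} [MeasurableSpace Ω] {P : Measure Ω}

theorem coe_indic (A : Set Ω) (hA : MeasurableSet A) :
    ∀ᵐ ω ∂P, (ω ∈ A → indic P A hA ω = 1) ∧ (ω ∉ A → indic P A hA ω = 0) := by
  filter_upwards [AEEqFun.coeFn_mk (μ := P) _
    (measurable_const.indicator hA : Measurable (A.indicator fun _ => (1 : ℝ))).aestronglyMeasurable]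
    with ω h
  unfold indic
  rw [h]
  exact ⟨fun h => indicator_of_mem h _, fun h => indicator_of_notMem h _⟩

theorem coe_glue {β : Type*} [TopologicalSpace β] (A : Set Ω) (hA : MeasurableSet A)
    (f g : Ω →ₘ[P] β) :
    ∀ᵐ ω ∂P, (ω ∈ A → glue A hA f g ω = f ω) ∧ (ω ∉ A → glue A hA f g ω = g ω) := by
  classical
  unfold glue
  filter_upwards [AEEqFun.coeFn_mk (μ := P) _ (AEStronglyMeasurable.piecewise hA
    f.aestronglyMeasurable.restrict g.aestronglyMeasurable.restrict)] with ω h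
  constructor <;> intro hω
  · refine Eq.trans ?_ (piecewise_eq_of_mem A (f : Ω → β) g hω)
    convert h
  · refine Eq.trans ?_ (piecewise_eq_of_notMem A (f : Ω → β) g hω)
    convert h

theorem coe_toE (s : L0 P) : ∀ᵐ ω ∂P, toE s ω = (s ω : EReal) :=
  AEEqFun.coeFn_comp _ _ s

theorem coe_mix (lam : L0 P) (s t : EL0 P) :
    ∀ᵐ ω ∂P, mix lam s t ω = (lam ω : EReal) * s ω + ((1 - lam ω : ℝ) : EReal) * t ω := by
  unfold mix
  filter_upwards [AEEqFun.coeFn_comp₂Measurable (fun x y : EReal => x + y) measurable_add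
    (AEEqFun.comp₂Measurable (fun (x : ℝ) (y : EReal) => (x : EReal) * y)
      ((measurable_fst.coe_real_ereal).mul measurable_snd) lam s)
    (AEEqFun.comp₂Measurable (fun (x : ℝ) (y : EReal) => (x : EReal) * y)
      ((measurable_fst.coe_real_ereal).mul measurable_snd) (1 - lam) t),
    AEEqFun.coeFn_comp₂Measurable (fun (x : ℝ) (y : EReal) => (x : EReal) * y)
      ((measurable_fst.coe_real_ereal).mul measurable_snd) lam s,
    AEEqFun.coeFn_comp₂Measurable (fun (x : ℝ) (y : EReal) => (x : EReal) * y)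
      ((measurable_fst.coe_real_ereal).mul measurable_snd) (1 - lam) t,
    AEEqFun.coeFn_sub 1 lam, AEEqFun.coeFn_one (α := Ω) (μ := P) (β := ℝ)] with ω h1 h2 h3 h4 h5
  rw [h1, h2, h3, h4, Pi.sub_apply, h5, Pi.one_apply]

theorem coe_divE (s : EL0 P) (lam : L0 P) :
    ∀ᵐ ω ∂P, divE s lam ω = (((lam ω)⁻¹ : ℝ) : EReal) * s ω :=
  AEEqFun.coeFn_comp₂Measurable _ _ _ _

theorem coe_mk {β : Type*} [TopologicalSpace β] [TopologicalSpace.PseudoMetrizableSpace β]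
    [SecondCountableTopology β] [MeasurableSpace β] [OpensMeasurableSpace β]
    {f : Ω → β} (hf : Measurable f) :
    ∀ᵐ ω ∂P, (AEEqFun.mk f hf.aestronglyMeasurable : Ω →ₘ[P] β) ω = f ω :=
  AEEqFun.coeFn_mk _ _

theorem coe_zero : ∀ᵐ ω ∂P, (0 : L0 P) ω = 0 := AEEqFun.coeFn_zero

theorem coe_one : ∀ᵐ ω ∂P, (1 : L0 P) ω = 1 := AEEqFun.coeFn_one

theorem coe_add (a b : L0 P) : ∀ᵐ ω ∂P, (a + b) ω = a ω + b ω := AEEqFun.coeFn_add a b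

theorem coe_sub (a b : L0 P) : ∀ᵐ ω ∂P, (a - b) ω = a ω - b ω := AEEqFun.coeFn_sub a b

theorem coe_mul (a b : L0 P) : ∀ᵐ ω ∂P, (a * b) ω = a ω * b ω := AEEqFun.coeFn_mul a b

theorem coe_neg (a : L0 P) : ∀ᵐ ω ∂P, (-a) ω = -a ω := AEEqFun.coeFn_neg a

theorem coe_const {β : Type*} [TopologicalSpace β] (b : β) :
    ∀ᵐ ω ∂P, (AEEqFun.const Ω b : Ω →ₘ[P] β) ω = b := AEEqFun.coeFn_const Ω b

theorem le_iff {β : Type*} [TopologicalSpace β] [Preorder β] {a b : Ω →ₘ[P] β} :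
    a ≤ b ↔ ∀ᵐ ω ∂P, a ω ≤ b ω := AEEqFun.coeFn_le.symm

theorem toE_le_toE {a b : L0 P} : toE a ≤ toE b ↔ a ≤ b := by
  rw [le_iff, le_iff]
  constructor <;> intro h
  · filter_upwards [h, coe_toE a, coe_toE b] with ω h1 h2 h3
    rw [h2, h3] at h1
    exact EReal.coe_le_coe_iff.1 h1
  · filter_upwards [h, coe_toE a, coe_toE b] with ω h1 h2 h3
    rw [h2, h3]
    exact EReal.coe_le_coe_iff.2 h1

instance : IsOrderedRing (L0 P) where
  add_le_add_left a b h c := le_iff.2 <| by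
    filter_upwards [le_iff.1 h, coe_add a c, coe_add b c] with ω h1 h2 h3
    rw [h2, h3]; linarith
  zero_le_one := le_iff.2 <| by
    filter_upwards [coe_zero (P := P), coe_one (P := P)] with ω h1 h2
    rw [h1, h2]; exact zero_le_one
  mul_le_mul_of_nonneg_left a ha b c h := le_iff.2 <| by
    filter_upwards [le_iff.1 h, le_iff.1 ha, coe_zero (P := P), coe_mul a b, coe_mul a c]
      with ω h1 h2 h3 h4 h5
    rw [h4, h5]; rw [h3] at h2; gcongr
  mul_le_mul_of_nonneg_right a ha b c h := le_iff.2 <| by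
    filter_upwards [le_iff.1 h, le_iff.1 ha, coe_zero (P := P), coe_mul b a, coe_mul c a]
      with ω h1 h2 h3 h4 h5
    rw [h4, h5]; rw [h3] at h2; gcongr

theorem Pos.nonneg {a : L0 P} (h : Pos a) : 0 ≤ a := le_iff.2 <| by
  filter_upwards [h, coe_zero (P := P)] with ω h1 h2
  rw [h2]; exact h1.le

theorem Pos.add_nonneg {a b : L0 P} (h : Pos a) (hb : 0 ≤ b) : Pos (a + b) := by
  filter_upwards [h, coe_zero (P := P), le_iff.1 hb, coe_add a b] with ω h1 h2 h3 h4
  rw [h4]; rw [h2] at h3; linarith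

theorem Pos.add {a b : L0 P} (h : Pos a) (hb : Pos b) : Pos (a + b) := h.add_nonneg hb.nonneg

theorem Pos.mul {a b : L0 P} (h : Pos a) (hb : Pos b) : Pos (a * b) := by
  filter_upwards [h, hb, coe_mul a b] with ω h1 h2 h4
  rw [h4]; positivity

theorem pos_const {c : ℝ} (hc : 0 < c) : Pos (AEEqFun.const Ω c : L0 P) := by
  filter_upwards [coe_const (P := P) c] with ω h
  rw [h]; exact hc

theorem pos_one : Pos (1 : L0 P) := by
  filter_upwards [coe_one (P := P)] with ω h
  rw [h]; exact one_pos

theorem Pos.exists_inv {a : L0 P} (h : Pos a) : ∃ b : L0 P, Pos b ∧ b * a = 1 := by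
  refine ⟨AEEqFun.mk _ a.measurable.inv.aestronglyMeasurable, ?_, ?_⟩
  · filter_upwards [h, coe_mk (P := P) a.measurable.inv] with ω h1 h2
    rw [h2]; exact inv_pos.2 h1
  · refine AEEqFun.ext ?_
    filter_upwards [h, coe_mk (P := P) a.measurable.inv, coe_mul (AEEqFun.mk _
      a.measurable.inv.aestronglyMeasurable) a, coe_one (P := P)] with ω h1 h2 h3 h4
    rw [h3, h2, h4]; exact inv_mul_cancel₀ h1.ne'

theorem indic_nonneg (A : Set Ω) (hA : MeasurableSet A) : 0 ≤ indic P A hA := le_iff.2 <| by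
  filter_upwards [coe_indic (P := P) A hA, coe_zero (P := P)] with ω h1 h2
  by_cases h : ω ∈ A
  · rw [h1.1 h, h2]; exact zero_le_one
  · rw [h1.2 h, h2]

theorem indic_add_compl (A : Set Ω) (hA : MeasurableSet A) :
    indic P A hA + indic P Aᶜ hA.compl = 1 := AEEqFun.ext <| by
  filter_upwards [coe_indic (P := P) A hA, coe_indic (P := P) Aᶜ hA.compl, coe_one (P := P),
    coe_add (indic P A hA) (indic P Aᶜ hA.compl)] with ω h1 h2 h3 h4
  rw [h3, h4]
  by_cases h : ω ∈ A
  · rw [h1.1 h, h2.2 (not_not.2 h), add_zero]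
  · rw [h1.2 h, h2.1 h, zero_add]

theorem indic_mul_compl (A : Set Ω) (hA : MeasurableSet A) :
    indic P A hA * indic P Aᶜ hA.compl = 0 := AEEqFun.ext <| by
  filter_upwards [coe_indic (P := P) A hA, coe_indic (P := P) Aᶜ hA.compl, coe_zero (P := P),
    coe_mul (indic P A hA) (indic P Aᶜ hA.compl)] with ω h1 h2 h3 h4
  rw [h3, h4]
  by_cases h : ω ∈ A
  · rw [h2.2 (not_not.2 h), mul_zero]
  · rw [h1.2 h, zero_mul]

theorem indic_mul_self (A : Set Ω) (hA : MeasurableSet A) :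
    indic P A hA * indic P A hA = indic P A hA := AEEqFun.ext <| by
  filter_upwards [coe_indic (P := P) A hA, coe_mul (indic P A hA) (indic P A hA)] with ω h1 h4
  rw [h4]
  by_cases h : ω ∈ A
  · rw [h1.1 h, mul_one]
  · rw [h1.2 h, zero_mul]

/-- Two random variables agree on `A` iff their products with `1_A` do. -/
theorem indic_mul_eq_iff {A : Set Ω} (hA : MeasurableSet A) {a b : L0 P} :
    indic P A hA * a = indic P A hA * b ↔ ∀ᵐ ω ∂P, ω ∈ A → a ω = b ω := by
  constructor <;> intro h
  · have h' : ∀ᵐ ω ∂P, (indic P A hA * a) ω = (indic P A hA * b) ω := by simp [h]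
    filter_upwards [h', coe_indic (P := P) A hA, coe_mul (indic P A hA) a,
      coe_mul (indic P A hA) b] with ω h1 h2 h3 h4 hω
    rw [h3, h4, h2.1 hω, one_mul, one_mul] at h1
    exact h1
  · refine AEEqFun.ext ?_
    filter_upwards [h, coe_indic (P := P) A hA, coe_mul (indic P A hA) a,
      coe_mul (indic P A hA) b] with ω h1 h2 h3 h4
    rw [h3, h4]
    by_cases hω : ω ∈ A
    · rw [h1 hω]
    · rw [h2.2 hω, zero_mul, zero_mul]

/-- Localised characterisation of lower bounds of the essential infimum. -/
theorem le_essinf_on [IsFiniteMeasure P] {A : Set Ω} (hA : MeasurableSet A) {S : Set (EL0 P)}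
    {m : EL0 P} :
    (∀ᵐ ω ∂P, ω ∈ A → m ω ≤ essinf S ω) ↔ ∀ f ∈ S, ∀ᵐ ω ∂P, ω ∈ A → m ω ≤ f ω := by
  constructor
  · intro h f hf
    filter_upwards [h, le_iff.1 ((isGLB_essinf S).1 hf)] with ω h1 h2 hω
    exact (h1 hω).trans h2
  · intro h
    have : glue A hA m (AEEqFun.const Ω ⊥) ≤ essinf S := (isGLB_essinf S).2 fun f hf => by
      rw [le_iff]
      filter_upwards [h f hf, coe_glue A hA m (AEEqFun.const Ω ⊥), coe_const (P := P) (⊥ : EReal)]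
        with ω h1 h2 h3
      by_cases hω : ω ∈ A
      · rw [h2.1 hω]; exact h1 hω
      · rw [h2.2 hω, h3]; exact bot_le
    filter_upwards [le_iff.1 this, coe_glue A hA m (AEEqFun.const Ω ⊥)] with ω h1 h2 hω
    rwa [h2.1 hω] at h1

/-- If `essinf S < m` on a nonnegligible set, then some element of `S` is `< m` on a nonnegligible
subset. -/
theorem exists_lt_of_essinf_lt [IsFiniteMeasure P] {A : Set Ω} (hA : MeasurableSet A)
    {S : Set (EL0 P)} {m : EL0 P} (hA0 : P A ≠ 0) (h : ∀ᵐ ω ∂P, ω ∈ A → essinf S ω < m ω) :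
    ∃ f ∈ S, ∃ B ⊆ A, MeasurableSet B ∧ P B ≠ 0 ∧ ∀ ω ∈ B, f ω < m ω := by
  by_contra hcon
  push Not at hcon
  -- If no f is below m on a nonnegligible part of A, then m is a lower bound of S on A, hence at
  -- most the essential infimum there.
  have key : ∀ f ∈ S, ∀ᵐ ω ∂P, ω ∈ A → m ω ≤ f ω := by
    intro f hf
    by_contra hn
    obtain ⟨ω, hω, hlt⟩ := hcon f hf (A ∩ {ω | f ω < m ω}) inter_subset_left
      (hA.inter (measurableSet_lt f.measurable m.measurable)) (fun h0 => hn <| by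
        rw [ae_iff]
        refine measure_mono_null (fun ω hω => ?_) h0
        simpa [and_comm] using hω)
    exact absurd hω.2 (not_lt.2 hlt)
  refine hA0 (measure_mono_null ?_ (ae_iff.1 (h.and ((le_essinf_on hA).2 key))))
  intro ω hω hh
  exact absurd (hh.1 hω) (not_lt.2 (hh.2 hω))

end Basics

/-! ### The Hahn–Banach theorem over `L⁰`, via minimal sublinear functionals. -/

section HahnBanach

variable {Ω : Type*} [MeasurableSpace Ω] {P : Measure Ω}

theorem le_of_sub_eq_sub {a b c d : L0 P} (h : a ≤ b) (e : b - a = d - c) : c ≤ d :=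
  sub_nonneg.1 (e ▸ sub_nonneg.2 h)

/-- Conditional completeness of `L⁰`. -/
theorem exists_isGLB_of_bddBelow [IsFiniteMeasure P] {S : Set (L0 P)} (hne : S.Nonempty)
    (hb : BddBelow S) : ∃ g, IsGLB S g ∧ toE g = essinf (toE '' S) := by
  obtain ⟨s, hs⟩ := hne
  obtain ⟨b, hb⟩ := hb
  have hG := isGLB_essinf (toE '' S)
  set G := essinf (toE '' S)
  have h1 : toE b ≤ G := hG.2 (by rintro _ ⟨x, hx, rfl⟩; exact toE_le_toE.2 (hb hx))
  have h2 : G ≤ toE s := hG.1 (mem_image_of_mem _ hs)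
  have hm : Measurable fun ω => (G ω).toReal := G.measurable.ereal_toReal
  have hg : toE (AEEqFun.mk _ hm.aestronglyMeasurable : L0 P) = G := by
    refine AEEqFun.ext ?_
    filter_upwards [le_iff.1 h1, le_iff.1 h2, coe_toE b, coe_toE s, coe_mk (P := P) hm,
      coe_toE (AEEqFun.mk _ hm.aestronglyMeasurable : L0 P)] with ω a1 a2 a3 a4 a5 a6
    rw [a6, a5]
    rw [a3] at a1
    rw [a4] at a2
    exact EReal.coe_toReal (ne_top_of_le_ne_top (EReal.coe_ne_top _) a2)
      (ne_bot_of_le_ne_bot (EReal.coe_ne_bot _) a1)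
  refine ⟨AEEqFun.mk _ hm.aestronglyMeasurable, ⟨fun x hx => ?_, fun l hl => ?_⟩, hg⟩
  · exact toE_le_toE.1 (hg.le.trans (hG.1 (mem_image_of_mem _ hx)))
  · refine toE_le_toE.1 ((hG.2 ?_).trans hg.ge)
    rintro _ ⟨x, hx, rfl⟩
    exact toE_le_toE.2 (hl hx)

theorem toE_eq_essinf_of_isGLB [IsFiniteMeasure P] {S : Set (L0 P)} {g : L0 P}
    (hne : S.Nonempty) (hg : IsGLB S g) : toE g = essinf (toE '' S) := by
  obtain ⟨g', h1, h2⟩ := exists_isGLB_of_bddBelow hne ⟨g, hg.1⟩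
  rw [← h2, hg.unique h1]

open Classical in
/-- The greatest lower bound in `L⁰` (`0` if there is none). -/
noncomputable def linf (S : Set (L0 P)) : L0 P := if h : ∃ g, IsGLB S g then h.choose else 0

theorem isGLB_linf [IsFiniteMeasure P] {S : Set (L0 P)} (hne : S.Nonempty) (hb : BddBelow S) :
    IsGLB S (linf S) := by
  have h := (exists_isGLB_of_bddBelow hne hb).imp fun _ h => h.1
  rw [linf, dif_pos h]
  exact h.choose_spec

/-- Division by c is possible only on {c ≠ 0}. On {c = 0} the hypothesis reads a ≤ 0, so the
competitor a/c is replaced there by g itself, which keeps it a lower bound of S. -/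
theorem le_mul_of_isGLB {S : Set (L0 P)} {g a c : L0 P} (hg : IsGLB S g) (hne : S.Nonempty)
    (hc : 0 ≤ c) (h : ∀ s ∈ S, a ≤ c * s) : a ≤ c * g := by
  have hm : Measurable fun ω => if c ω = 0 then g ω else (c ω)⁻¹ * a ω :=
    Measurable.ite (c.measurable (measurableSet_singleton 0)) g.measurable
      (c.measurable.inv.mul a.measurable)
  have key : (AEEqFun.mk _ hm.aestronglyMeasurable : L0 P) ≤ g := hg.2 fun s hs => by
    rw [le_iff]
    filter_upwards [le_iff.1 (h s hs), le_iff.1 (hg.1 hs), le_iff.1 hc, coe_mk (P := P) hm,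
      coe_mul c s, coe_zero (P := P)] with ω h1 h2 h3 h4 h5 h6
    rw [h4]
    rw [h5] at h1
    rw [h6] at h3
    split_ifs with h0
    · exact h2
    · exact (inv_mul_le_iff₀ (lt_of_le_of_ne h3 (Ne.symm h0))).2 h1
  obtain ⟨s, hs⟩ := hne
  rw [le_iff]
  filter_upwards [le_iff.1 (h s hs), le_iff.1 key, le_iff.1 hc, coe_mk (P := P) hm,
      coe_mul c s, coe_mul c g, coe_zero (P := P)] with ω h1 h2 h3 h4 h5 h6 h7
  rw [h4] at h2
  rw [h5] at h1
  rw [h6]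
  rw [h7] at h3
  split_ifs at h2 with h0
  · rw [h0, zero_mul] at h1 ⊢
    exact h1
  · exact (inv_mul_le_iff₀ (lt_of_le_of_ne h3 (Ne.symm h0))).1 h2

variable {F : Type*} [AddCommGroup F] [Module (L0 P) F]

/-- `L⁰`-sublinear functionals. -/
structure IsSublinear (p : F → L0 P) : Prop where
  add_le : ∀ x y, p (x + y) ≤ p x + p y
  smul_le : ∀ (c : L0 P) x, 0 ≤ c → p (c • x) ≤ c * p x

namespace IsSublinear

variable {p q : F → L0 P}

theorem apply_zero (hp : IsSublinear p) : p 0 = 0 := by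
  apply le_antisymm
  · simpa using hp.smul_le 0 0 le_rfl
  · have := hp.add_le 0 0
    rw [add_zero] at this
    exact le_of_sub_eq_sub this (by ring)

theorem apply_smul (hp : IsSublinear p) {c : L0 P} (hc : Pos c) (x : F) :
    p (c • x) = c * p x := by
  refine le_antisymm (hp.smul_le c x hc.nonneg) ?_
  obtain ⟨d, hd, h⟩ := hc.exists_inv
  have := mul_le_mul_of_nonneg_left (hp.smul_le d (c • x) hd.nonneg) hc.nonneg
  rwa [smul_smul, h, one_smul, ← mul_assoc, mul_comm c d, h, one_mul] at this

theorem neg_apply_neg_le (hp : IsSublinear p) (x : F) : -p (-x) ≤ p x := by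
  have := hp.add_le x (-x)
  rw [add_neg_cancel, hp.apply_zero] at this
  exact le_of_sub_eq_sub this (by ring)

/-- The directional modification `y ↦ inf_{t > 0} (p (y + t x) - t p x)` of a sublinear
functional. -/
theorem exists_directional [IsFiniteMeasure P] (hp : IsSublinear p) (x : F) :
    ∃ r : F → L0 P, IsSublinear r ∧ (∀ y, r y ≤ p y) ∧
      ∀ y (t : L0 P), Pos t → r y ≤ p (y + t • x) - t * p x := by
  let S : F → Set (L0 P) := fun y => {a | ∃ t : L0 P, Pos t ∧ a = p (y + t • x) - t * p x}
  have hS : ∀ y, (S y).Nonempty := fun y => ⟨_, 1, pos_one, rfl⟩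
  have hb : ∀ y, BddBelow (S y) := fun y => ⟨-p (-y), by
    rintro _ ⟨t, ht, rfl⟩
    have := hp.add_le (y + t • x) (-y)
    rw [add_neg_cancel_comm, hp.apply_smul ht] at this
    exact le_of_sub_eq_sub this (by ring)⟩
  have hr : ∀ y, IsGLB (S y) (linf (S y)) := fun y => isGLB_linf (hS y) (hb y)
  have hle : ∀ y (t : L0 P), Pos t → linf (S y) ≤ p (y + t • x) - t * p x := fun y t ht =>
    (hr y).1 ⟨t, ht, rfl⟩
  refine ⟨fun y => linf (S y), ⟨fun y z => ?_, fun c y hc => ?_⟩, fun y => ?_, hle⟩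
  · rw [← sub_le_iff_le_add]
    refine (hr y).2 ?_
    rintro _ ⟨t, ht, rfl⟩
    rw [sub_le_comm]
    refine (hr z).2 ?_
    rintro _ ⟨s, hs, rfl⟩
    have h1 := hle (y + z) (t + s) (ht.add hs)
    have h2 := hp.add_le (y + t • x) (z + s • x)
    rw [show y + t • x + (z + s • x) = y + z + (t + s) • x by rw [add_smul]; abel] at h2
    exact le_of_sub_eq_sub (add_le_add h1 h2) (by ring)
  · refine le_mul_of_isGLB (hr y) (hS y) hc ?_
    rintro _ ⟨t, ht, rfl⟩
    -- Since c may vanish on part of Ω, ct need not be an admissible step; 1 + ct is, and the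
    -- surplus x costs at most p(x), which cancels.
    have h1 := hle (c • y) (1 + c * t) (pos_one.add_nonneg (mul_nonneg hc ht.nonneg))
    have h2 := hp.add_le (c • (y + t • x)) x
    have h3 := hp.smul_le c (y + t • x) hc
    rw [show c • (y + t • x) + x = c • y + (1 + c * t) • x by
      rw [add_smul, smul_add, smul_smul, one_smul]; abel] at h2
    exact le_of_sub_eq_sub (add_le_add (add_le_add h1 h2) h3) (by ring)
  · have h1 := hle y 1 pos_one
    have h2 := hp.add_le y ((1 : L0 P) • x)
    rw [hp.apply_smul pos_one] at h2
    exact le_of_sub_eq_sub (add_le_add h1 h2) (by ring)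

/-- Below every sublinear functional there is a minimal one. -/
theorem exists_minimal [IsFiniteMeasure P] (hq : IsSublinear q) :
    ∃ p : F → L0 P, IsSublinear p ∧ (∀ x, p x ≤ q x) ∧
      ∀ r : F → L0 P, IsSublinear r → (∀ x, r x ≤ p x) → ∀ x, p x ≤ r x := by
  let T := {p : F → L0 P // IsSublinear p ∧ ∀ x, p x ≤ q x}
  have : Nonempty T := ⟨⟨q, hq, fun _ => le_rfl⟩⟩
  obtain ⟨p, hp⟩ := exists_maximal_of_nonempty_chains_bounded
    (r := fun a b : T => ∀ x, b.1 x ≤ a.1 x) (fun C hC hne => by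
      let S : F → Set (L0 P) := fun x => {a | ∃ p ∈ C, a = p.1 x}
      have hS : ∀ x, (S x).Nonempty := fun x => ⟨_, hne.some, hne.some_mem, rfl⟩
      have hb : ∀ x, BddBelow (S x) := fun x => ⟨-q (-x), by
        rintro _ ⟨p, -, rfl⟩
        exact (neg_le_neg (p.2.2 (-x))).trans (p.2.1.neg_apply_neg_le x)⟩
      have hr : ∀ x, IsGLB (S x) (linf (S x)) := fun x => isGLB_linf (hS x) (hb x)
      refine ⟨⟨fun x => linf (S x), ⟨fun x y => ?_, fun c x hc => ?_⟩, fun x => ?_⟩,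
        fun p hp x => (hr x).1 ⟨p, hp, rfl⟩⟩
      · rw [← sub_le_iff_le_add]
        refine (hr x).2 ?_
        rintro _ ⟨p, hp, rfl⟩
        rw [sub_le_comm]
        refine (hr y).2 ?_
        rintro _ ⟨p', hp', rfl⟩
        obtain ⟨m, hm, h1, h2⟩ : ∃ m ∈ C, (∀ x, m.1 x ≤ p.1 x) ∧ ∀ x, m.1 x ≤ p'.1 x := by
          rcases eq_or_ne p p' with rfl | hne
          · exact ⟨p, hp, fun _ => le_rfl, fun _ => le_rfl⟩
          · rcases hC hp hp' hne with h | h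
            · exact ⟨p', hp', h, fun _ => le_rfl⟩
            · exact ⟨p, hp, fun _ => le_rfl, h⟩
        rw [sub_le_iff_le_add']
        exact ((hr (x + y)).1 ⟨m, hm, rfl⟩).trans
          ((m.2.1.add_le x y).trans (add_le_add (h1 x) (h2 y)))
      · refine le_mul_of_isGLB (hr x) (hS x) hc ?_
        rintro _ ⟨p, hp, rfl⟩
        exact ((hr (c • x)).1 ⟨p, hp, rfl⟩).trans (p.2.1.smul_le c x hc)
      · exact ((hr x).1 ⟨_, hne.some_mem, rfl⟩).trans (hne.some.2.2 x))
    (fun h1 h2 x => (h2 x).trans (h1 x))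
  exact ⟨p.1, p.2.1, p.2.2, fun r hr hrp => hp ⟨r, hr, fun x => (hrp x).trans (p.2.2 x)⟩ hrp⟩

/-- The Hahn–Banach theorem for `L⁰`-modules: a sublinear functional dominates a linear functional
that touches it at a given point. -/
theorem exists_linear [IsFiniteMeasure P] (hq : IsSublinear q) (x₀ : F) :
    ∃ f : F →ₗ[L0 P] L0 P, (∀ x, f x ≤ q x) ∧ f x₀ = q x₀ := by
  obtain ⟨r, hr, hrq, hrx⟩ := hq.exists_directional x₀
  obtain ⟨p, hp, hpr, hmin⟩ := hr.exists_minimal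
  have hadd : ∀ x y, p (x + y) = p x + p y := fun x y => by
    refine le_antisymm (hp.add_le x y) ?_
    -- Minimality forces p to coincide with its modification in direction y, so p(x) ≤ p(x + y) -
    -- p(y): a minimal sublinear functional is additive.
    obtain ⟨s, hs, hsp, hsx⟩ := hp.exists_directional y
    have h1 := hmin s hs hsp x
    have h2 := hsx x 1 pos_one
    rw [one_smul, one_mul] at h2
    exact le_sub_iff_add_le.1 (h1.trans h2)
  have hneg : ∀ x, p (-x) = -p x := fun x => by
    have := hadd x (-x)
    rw [add_neg_cancel, hp.apply_zero] at this
    exact eq_neg_of_add_eq_zero_right this.symm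
  have hpos : ∀ (c : L0 P) x, 0 ≤ c → p (c • x) = c * p x := fun c x hc => by
    refine le_antisymm (hp.smul_le c x hc) ?_
    have := hp.smul_le c (-x) hc
    rw [smul_neg, hneg, hneg, mul_neg] at this
    exact neg_le_neg_iff.1 this
  refine ⟨⟨⟨p, hadd⟩, fun c x => ?_⟩, fun x => (hpr x).trans (hrq x), ?_⟩
  · have hc : (c ⊔ 0) - ((-c) ⊔ 0) = c := AEEqFun.ext <| by
      filter_upwards [coe_sub (c ⊔ 0) ((-c) ⊔ 0), AEEqFun.coeFn_sup c 0, AEEqFun.coeFn_sup (-c) 0,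
        coe_neg c, coe_zero (P := P)] with ω h1 h2 h3 h4 h5
      rw [h1, h2, h3, h4, h5]
      exact max_zero_sub_max_neg_zero_eq_self _
    change p (c • x) = c * p x
    rw [← hc, sub_smul, sub_eq_add_neg, hadd, hneg, hpos _ _ le_sup_right, hpos _ _ le_sup_right]
    ring
  · change p x₀ = q x₀
    apply le_antisymm ((hpr _).trans (hrq _))
    -- Starting from the modification of q in direction x₀ pins the value: r(-x₀) ≤ q(0) - q(x₀) =
    -- -q(x₀), hence p(x₀) ≥ q(x₀).
    have h1 := hpr (-x₀)
    have h2 := hrx (-x₀) 1 pos_one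
    rw [one_smul, neg_add_cancel, hq.apply_zero, one_mul, zero_sub] at h2
    rw [hneg] at h1
    exact neg_le_neg_iff.1 (h1.trans h2)

end IsSublinear

end HahnBanach

/-! ### Separating a point from a cone by a gauge. -/

section Separation

variable {Ω : Type*} [MeasurableSpace Ω] {P : Measure Ω}

/-- The essential infimum of a nonempty set is the infimum of a sequence in the set. -/
theorem exists_seq_essinf [IsFiniteMeasure P] {S : Set (EL0 P)} (hS : S.Nonempty) :
    ∃ F : ℕ → EL0 P, (∀ n, F n ∈ S) ∧ ∀ᵐ ω ∂P, essinf S ω = ⨅ n, F n ω := by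
  let φ : EReal → ENNReal := fun x => (1 + x.exp)⁻¹
  have hφm : Measurable φ := by fun_prop
  have hφanti : ∀ {x y}, x ≤ y → φ y ≤ φ x := fun h =>
    ENNReal.inv_le_inv.2 (add_le_add le_rfl (EReal.exp_monotone h))
  have hφinj : ∀ {x y}, φ x = φ y → x = y := fun {x y} h => by
    have h1 : (1 : ENNReal) + x.exp = 1 + y.exp := inv_injective h
    exact EReal.exp_strictMono.injective ((ENNReal.add_right_inj ENNReal.one_ne_top).1 h1)
  -- Sequences are ranked by the integral of a bounded strictly decreasing function of their
  -- infimum. Merging a maximising sequence of sequences gives a maximiser; adjoining any element of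
  -- S cannot lower its infimum on a nonnegligible set.
  let I : (ℕ → S) → ENNReal := fun f => ∫⁻ ω, φ (⨅ n, (f n : EL0 P) ω) ∂P
  have hmeas : ∀ f : ℕ → S, Measurable fun ω => ⨅ n, (f n : EL0 P) ω := fun f =>
    Measurable.iInf fun n => (f n : EL0 P).measurable
  have : Nonempty (ℕ → S) := ⟨fun _ => ⟨hS.some, hS.some_mem⟩⟩
  obtain ⟨u, -, hu, huI⟩ := exists_seq_tendsto_sSup (range_nonempty I) (OrderTop.bddAbove _)
  choose v hv using huI
  let F : ℕ → S := fun k => v k.unpair.1 k.unpair.2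
  have hF : ∀ G : ℕ → S, I G ≤ I F := fun G => by
    refine (le_sSup (mem_range_self G)).trans (le_of_tendsto' hu fun k => ?_)
    rw [← hv k]
    refine lintegral_mono fun ω => hφanti (le_iInf fun n => ?_)
    refine (iInf_le _ (Nat.pair k n)).trans ?_
    simp [F]
  have hfin : I F ≠ ⊤ := by
    refine ne_top_of_le_ne_top (measure_ne_top P univ) ?_
    calc I F ≤ ∫⁻ _, 1 ∂P := lintegral_mono fun ω => ENNReal.inv_le_one.2 le_self_add
      _ = P univ := lintegral_one
  refine ⟨fun n => F n, fun n => (F n).2, ?_⟩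
  have hle : (AEEqFun.mk _ (hmeas F).aestronglyMeasurable : EL0 P) ≤ essinf S :=
    (isGLB_essinf S).2 fun h hh => by
      let G : ℕ → S := fun n => Nat.casesOn (motive := fun _ => S) n ⟨h, hh⟩ F
      have hGF : ∀ ω, (⨅ n, (G n).1 ω) ≤ ⨅ n, (F n).1 ω := fun ω =>
        le_iInf fun n => iInf_le (fun k => (G k).1 ω) (n + 1)
      have hae := ae_eq_of_ae_le_of_lintegral_le (μ := P)
        (Eventually.of_forall fun ω => hφanti (hGF ω)) hfin
        (hφm.comp (hmeas G)).aemeasurable (hF G)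
      rw [le_iff]
      filter_upwards [hae, coe_mk (P := P) (hmeas F)] with ω h1 h2
      rw [h2, hφinj h1]
      exact iInf_le (fun n => (G n).1 ω) 0
  have hall : ∀ᵐ ω ∂P, ∀ n, essinf S ω ≤ (F n : EL0 P) ω :=
    ae_all_iff.2 fun n => le_iff.1 ((isGLB_essinf S).1 (F n).2)
  filter_upwards [hall, le_iff.1 hle, coe_mk (P := P) (hmeas F)] with ω h1 h2 h3
  rw [h3] at h2
  exact le_antisymm (le_iInf h1) h2

/-- A measurable cover (up to a null set) has a subordinate measurable partition. -/
theorem exists_isPartition {B : ℕ → Set Ω} (hB : ∀ n, MeasurableSet (B n))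
    (h : ∀ᵐ ω ∂P, ∃ n, ω ∈ B n) :
    ∃ A : ℕ → Set Ω, IsPartition A ∧ ∀ n, ∀ᵐ ω ∂P, ω ∈ A n → ω ∈ B n := by
  -- The uncovered null set is added so that the partition covers all of Ω, not merely almost all.
  let C : ℕ → Set Ω := fun n => B n ∪ (⋃ k, B k)ᶜ
  have hC : ∀ n, MeasurableSet (C n) := fun n => (hB n).union (MeasurableSet.iUnion hB).compl
  refine ⟨disjointed C, ⟨fun n => MeasurableSet.disjointed hC n, disjoint_disjointed C, ?_⟩,
    fun n => ?_⟩
  · rw [iUnion_disjointed, eq_univ_iff_forall]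
    intro ω
    by_cases hω : ω ∈ ⋃ k, B k
    · obtain ⟨k, hk⟩ := mem_iUnion.1 hω
      exact mem_iUnion.2 ⟨k, Or.inl hk⟩
    · exact mem_iUnion.2 ⟨0, Or.inr hω⟩
  · filter_upwards [h] with ω hω hA
    rcases disjointed_subset C n hA with h1 | h1
    · exact h1
    · exact absurd (mem_iUnion.2 hω) h1

variable {F : Type*} [AddCommGroup F] [Module (L0 P) F]

/-- `C` contains, for all sequences in `C`, some concatenation along each partition. -/
def SigmaComplete (P : Measure Ω) {F : Type*} [AddCommGroup F] [Module (L0 P) F]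
    (C : Set F) : Prop :=
  ∀ (A : ℕ → Set Ω) (hA : IsPartition A) (x : ℕ → F), (∀ i, x i ∈ C) → ∃ y ∈ C, IsConcat P hA x y

/-- `L⁰`-convex cones containing `0`. -/
structure IsL0Cone (P : Measure Ω) {F : Type*} [AddCommGroup F] [Module (L0 P) F]
    (C : Set F) : Prop where
  zero_mem : (0 : F) ∈ C
  add_mem : ∀ x ∈ C, ∀ y ∈ C, x + y ∈ C
  smul_mem : ∀ lam : L0 P, 0 ≤ lam → ∀ x ∈ C, lam • x ∈ C

/-- When a + b is strictly positive, ax + by is (a + b) times a convex combination. Sums use a = b =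
1; a factor c that may vanish is handled as c·x + 1·0. -/
theorem IsL0Cone.of_convex {C : Set F} (h0 : (0 : F) ∈ C) (hc : L0Convex P C)
    (hs : ∀ lam : L0 P, Pos lam → ∀ x ∈ C, lam • x ∈ C) : IsL0Cone P C := by
  have half : UnitInterval (AEEqFun.const Ω (1 / 2) : L0 P) := by
    filter_upwards [coe_const (P := P) (1 / 2 : ℝ)] with ω h
    rw [h]; norm_num
  have hcomb : ∀ a b : L0 P, 0 ≤ a → 0 ≤ b → Pos (a + b) → ∀ x ∈ C, ∀ y ∈ C,
      a • x + b • y ∈ C := by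
    intro a b ha hb hab x hx y hy
    obtain ⟨i, hi, h1⟩ := hab.exists_inv
    have hU : UnitInterval (i * a) := by
      have h2 := le_iff.1 (mul_nonneg hi.nonneg ha)
      have h3 : i * a ≤ 1 := by
        refine le_of_sub_eq_sub (mul_nonneg hi.nonneg hb) ?_
        rw [← h1]; ring
      filter_upwards [h2, le_iff.1 h3, coe_zero (P := P), coe_one (P := P)] with ω h4 h5 h6 h7
      rw [h6] at h4
      rw [h7] at h5
      exact ⟨h4, h5⟩
    have := hs _ hab _ (hc x hx y hy _ hU)
    rw [smul_add, smul_smul, smul_smul, mul_sub, ← mul_assoc, mul_comm (a + b) i, h1] at this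
    simpa using this
  refine ⟨h0, fun x hx y hy => ?_, fun c hc x hx => ?_⟩
  · simpa using hcomb 1 1 pos_one.nonneg pos_one.nonneg (pos_one.add pos_one) x hx y hy
  · simpa using hcomb c 1 hc pos_one.nonneg (add_comm 1 c ▸ pos_one.add_nonneg hc) x hx 0 h0

/-- Separation of a point from a cone, relative to a convex, absorbent, balanced set. -/
theorem exists_separation [IsFiniteMeasure P] {C U : Set F} (hC : IsL0Cone P C)
    (hCs : SigmaComplete P C) (hUc : L0Convex P U) (hUa : L0Absorbent P U) (hUb : L0Balanced P U)
    (hUs : SigmaStable P U) {x₀ : F} (hx₀ : ∀ c ∈ C, x₀ - c ∉ U) :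
    ∃ f : F →ₗ[L0 P] L0 P, (∀ c ∈ C, 0 ≤ f c) ∧ (∀ u ∈ U, f u ≤ 1) ∧ ¬ 0 ≤ f x₀ := by
  -- The sublinear functional is the gauge of U modulo C. It vanishes on C and is at most 1 on U;
  -- minus a linear functional below it that touches it at x₀ will separate.
  let S : F → Set (L0 P) := fun y => {a | Pos a ∧ ∃ u ∈ U, ∃ c ∈ C, y = a • u + c}
  have hS : ∀ y, (S y).Nonempty := fun y => by
    obtain ⟨a, ha, u, hu, h⟩ := hUa y
    exact ⟨a, ha, u, hu, 0, hC.zero_mem, by rw [h, add_zero]⟩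
  have hb : ∀ y, BddBelow (S y) := fun y => ⟨0, fun a ha => ha.1.nonneg⟩
  have hr : ∀ y, IsGLB (S y) (linf (S y)) := fun y => isGLB_linf (hS y) (hb y)
  have h0U : (0 : F) ∈ U := by
    obtain ⟨a, ha, u, hu, -⟩ := hUa 0
    have := hUb u hu 0 (by
      filter_upwards [coe_zero (P := P)] with ω h
      rw [h]; simp)
    rwa [zero_smul] at this
  have le_of_eps : ∀ a b : L0 P, (∀ e, Pos e → a ≤ b + e) → a ≤ b := by
    intro a b h
    have : ∀ᵐ ω ∂P, ∀ n : ℕ, a ω ≤ b ω + 1 / ((n : ℝ) + 1) := ae_all_iff.2 fun n => by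
      filter_upwards [le_iff.1 (h _ (pos_const (Nat.one_div_pos_of_nat (α := ℝ) (n := n)))),
        coe_add b (AEEqFun.const Ω (1 / ((n : ℝ) + 1))), coe_const (P := P) (1 / ((n : ℝ) + 1))]
        with ω h1 h2 h3
      rwa [h2, h3] at h1
    rw [le_iff]
    filter_upwards [this] with ω hω
    refine le_of_forall_pos_le_add fun e he => ?_
    obtain ⟨n, hn⟩ := exists_nat_one_div_lt he
    linarith [hω n]
  have hsub : IsSublinear fun y => linf (S y) := by
    refine ⟨fun y z => ?_, fun c y hc => ?_⟩
    · rw [← sub_le_iff_le_add]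
      refine (hr y).2 ?_
      rintro a ⟨ha, u, hu, k, hk, rfl⟩
      rw [sub_le_comm]
      refine (hr z).2 ?_
      rintro b ⟨hb, v, hv, l, hl, rfl⟩
      rw [sub_le_iff_le_add']
      refine (hr _).1 ⟨ha.add hb, ?_⟩
      obtain ⟨i, hi, h1⟩ := (ha.add hb).exists_inv
      have hU : UnitInterval (i * a) := by
        have h2 := le_iff.1 (mul_nonneg hi.nonneg ha.nonneg)
        have h3 : i * a ≤ 1 := by
          refine le_of_sub_eq_sub (mul_nonneg hi.nonneg hb.nonneg) ?_
          rw [← h1]; ring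
        filter_upwards [h2, le_iff.1 h3, coe_zero (P := P), coe_one (P := P)] with ω h4 h5 h6 h7
        rw [h6] at h4
        rw [h7] at h5
        exact ⟨h4, h5⟩
      refine ⟨_, hUc u hu v hv _ hU, k + l, hC.add_mem k hk l hl, ?_⟩
      rw [smul_add, smul_smul, smul_smul, mul_sub, ← mul_assoc, mul_comm (a + b) i, h1, one_mul,
        mul_one, add_sub_cancel_left]
      abel
    · refine le_mul_of_isGLB (hr y) (hS y) hc ?_
      rintro a ⟨ha, u, hu, k, hk, rfl⟩
      -- The product ca may vanish somewhere, whereas members of `S` are strictly positive; the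
      -- slack e repairs this and balancedness of U absorbs the ratio ca/(ca + e).
      refine le_of_eps _ _ fun e he => ?_
      have hce : Pos (c * a + e) :=
        add_comm e (c * a) ▸ he.add_nonneg (mul_nonneg hc ha.nonneg)
      obtain ⟨i, hi, h1⟩ := hce.exists_inv
      refine (hr _).1 ⟨hce, _, hUb u hu (i * (c * a)) ?_, c • k, hC.smul_mem c hc k hk, ?_⟩
      · have h2 := le_iff.1 (mul_nonneg hi.nonneg (mul_nonneg hc ha.nonneg))
        have h3 : i * (c * a) ≤ 1 := by
          refine le_of_sub_eq_sub (mul_nonneg hi.nonneg he.nonneg) ?_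
          rw [← h1]; ring
        filter_upwards [h2, le_iff.1 h3, coe_zero (P := P), coe_one (P := P)] with ω h4 h5 h6 h7
        rw [h6] at h4
        rw [h7] at h5
        rwa [abs_of_nonneg h4]
      · rw [smul_smul, ← mul_assoc, mul_comm _ i, h1, one_mul, smul_add, smul_smul]
  obtain ⟨f, hf, hfx⟩ := hsub.exists_linear x₀
  refine ⟨-f, fun c hc => ?_, fun u hu => ?_, fun hcon => ?_⟩
  · rw [LinearMap.neg_apply, neg_nonneg]
    refine le_of_eps _ _ fun e he => (hf c).trans ((hr c).1 ?_)
    rw [zero_add]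
    exact ⟨he, 0, h0U, c, hc, by rw [smul_zero, zero_add]⟩
  · rw [LinearMap.neg_apply, ← map_neg]
    refine (hf _).trans ((hr _).1 ⟨pos_one, -u, ?_, 0, hC.zero_mem, by simp⟩)
    have := hUb u hu (-1) (by
      filter_upwards [coe_neg (1 : L0 P), coe_one (P := P)] with ω h1 h2
      rw [h1, h2]; simp)
    rwa [neg_smul, one_smul] at this
  · rw [LinearMap.neg_apply, hfx, neg_nonneg] at hcon
    -- If the gauge of x₀ were ≤ 0, countably many admissible a_n would satisfy a_n < 1 on sets
    -- covering Ω. Concatenating the decompositions along a subordinate partition writes x₀ as k + u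
    -- with k in C and u in U, which is excluded.
    obtain ⟨G, hG, hGe⟩ := exists_seq_essinf ((hS x₀).image toE)
    choose a haS haG using hG
    have hle : essinf (toE '' S x₀) ≤ toE 0 := by
      rw [← toE_eq_essinf_of_isGLB (hS x₀) (hr x₀)]
      exact toE_le_toE.2 hcon
    have hcov : ∀ᵐ ω ∂P, ∃ n, ω ∈ {ω | a n ω < 1} := by
      have hall : ∀ᵐ ω ∂P, ∀ n, G n ω = (a n ω : EReal) := ae_all_iff.2 fun n => by
        rw [← haG n]; exact coe_toE (a n)
      filter_upwards [hall, hGe, le_iff.1 hle, coe_toE (0 : L0 P), coe_zero (P := P)]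
        with ω h1 h2 h3 h4 h5
      rw [h2, h4, h5] at h3
      obtain ⟨n, hn⟩ := iInf_lt_iff.1 (lt_of_le_of_lt h3 (EReal.coe_lt_coe_iff.2 zero_lt_one))
      rw [h1] at hn
      exact ⟨n, EReal.coe_lt_coe_iff.1 hn⟩
    obtain ⟨A, hA, hAB⟩ := exists_isPartition
      (fun n => measurableSet_lt (a n).measurable measurable_const) hcov
    choose hap u hu c hc heq using haS
    obtain ⟨k, hk, hck⟩ := hCs A hA c hc
    refine hx₀ k hk (hUs A hA (fun n => (indic P (A n) (hA.measurable n) * a n) • u n) _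
      (fun n => hUb _ (hu n) _ ?_) fun n => ?_)
    · filter_upwards [hAB n, coe_indic (P := P) (A n) (hA.measurable n), hap n,
        coe_mul (indic P (A n) (hA.measurable n)) (a n)] with ω h1 h2 h3 h4
      rw [h4]
      by_cases hω : ω ∈ A n
      · rw [h2.1 hω, one_mul, abs_of_pos h3]; exact (h1 hω).le
      · rw [h2.2 hω, zero_mul, abs_zero]; exact zero_le_one
    · rw [smul_sub, hck n, ← smul_sub, smul_smul, ← mul_assoc, indic_mul_self, ← smul_smul]
      congr 1
      conv_lhs => rw [heq n]
      rw [add_sub_cancel_right]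

end Separation

/-! ### Closed sets and limits in `L⁰`. -/

section Topology

variable {Ω : Type*} [MeasurableSpace Ω] {P : Measure Ω}

theorem isClosed_nonneg_on (B : Set Ω) :
    IsClosed {z : L0 P | ∀ᵐ ω ∂P, ω ∈ B → 0 ≤ z ω} := by
  rw [← isOpen_compl_iff, isOpen_iff_mem_nhds]
  intro z hz
  -- A ball of radius -z/2 on {z < 0} keeps its points negative wherever z is; elsewhere any
  -- positive radius will do.
  have hm : Measurable fun ω => if z ω < 0 then -z ω / 2 else 1 :=
    Measurable.ite (measurableSet_lt z.measurable measurable_const)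
      (z.measurable.neg.div_const 2) measurable_const
  refine mem_nhds_L0.2 ⟨AEEqFun.mk _ hm.aestronglyMeasurable, ?_, fun n hn hcon => hz ?_⟩
  · filter_upwards [coe_mk (P := P) hm] with ω h
    rw [h]
    split_ifs with h0
    · linarith
    · exact one_pos
  · change ∀ᵐ ω ∂P, ω ∈ B → 0 ≤ z ω
    filter_upwards [coe_mk (P := P) hm, hn, hcon] with ω h1 h2 h3 hω
    by_contra hneg
    rw [h1, if_pos (not_le.1 hneg)] at h2
    have := (abs_le.1 h2).1
    linarith [h3 hω, not_le.1 hneg]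

/-- Zero is a limit of strictly positive elements: the ball of radius ε around 0 contains ε itself.
-/
theorem apply_zero_mem_of_isClosed {X : Type*} [TopologicalSpace X] {C : Set X} (hC : IsClosed C)
    {g : L0 P → X} (hg : Continuous g) (h : ∀ lam, Pos lam → g lam ∈ C) : g 0 ∈ C := by
  have h0 : (0 : L0 P) ∈ closure {lam : L0 P | Pos lam} := by
    rw [mem_closure_iff_nhds]
    intro W hW
    obtain ⟨ε, hε, hεW⟩ := mem_nhds_L0.1 hW
    refine ⟨ε, hεW ε ?_, hε⟩
    filter_upwards [hε, coe_zero (P := P)] with ω h1 h2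
    rw [h2, zero_sub, abs_neg, abs_of_pos h1]
  exact closure_minimal (fun lam hl => h lam hl) (hC.preimage hg) h0

end Topology

/-! ### Acceptance cones, critical levels and dual separation. -/

section Index

variable {Ω : Type*} [MeasurableSpace Ω] {P : Measure Ω}
  {E : Type*} [AddCommGroup E] [Module (L0 P) E]

theorem eq_indic_add_compl (A : Set Ω) (hA : MeasurableSet A) (x : E) :
    x = indic P A hA • x + indic P Aᶜ hA.compl • x := by
  rw [← add_smul, indic_add_compl, one_smul]

variable {K : Set E} {α : E → EL0 P}

theorem IsAssessmentIndex.indic_smul (hα : IsAssessmentIndex K α) (A : Set Ω)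
    (hA : MeasurableSet A) (x : E) : α (indic P A hA • x) = glue A hA (α x) (α 0) := by
  have := hα.isLocal A hA x 0
  rwa [smul_zero, add_zero] at this

theorem IsAssessmentIndex.congr_on (hα : IsAssessmentIndex K α) {A : Set Ω}
    (hA : MeasurableSet A) {x y : E} (h : indic P A hA • x = indic P A hA • y) :
    ∀ᵐ ω ∂P, ω ∈ A → α x ω = α y ω := by
  have h1 := hα.indic_smul A hA x
  rw [h, hα.indic_smul A hA y] at h1
  filter_upwards [coe_glue A hA (α x) (α 0), coe_glue A hA (α y) (α 0)] with ω h2 h3 hω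
  rw [← h2.1 hω, ← h3.1 hω, h1]

theorem IsAssessmentIndex.sigmaStable (hα : IsAssessmentIndex K α) (m : EL0 P) :
    SigmaStable P {x | m ≤ α x} := fun A hA x y hx hy => by
  have hall : ∀ᵐ ω ∂P, ∀ i, ω ∈ A i → m ω ≤ α y ω := ae_all_iff.2 fun i => by
    filter_upwards [hα.congr_on (hA.measurable i) (hy i), le_iff.1 (hx i)] with ω h1 h2 hω
    rwa [h1 hω]
  refine le_iff.2 ?_
  filter_upwards [hall] with ω hω
  obtain ⟨i, hi⟩ := mem_iUnion.1 (hA.cover ▸ mem_univ ω : ω ∈ ⋃ i, A i)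
  exact hω i hi

theorem le_apply_zero {E : Type*} [Zero E] {α : E → EL0 P} (h0 : ∀ᵐ ω ∂P, α 0 ω = ⊤) (m : EL0 P) : m ≤ α 0 := le_iff.2 <| by
  filter_upwards [h0] with ω h
  rw [h]; exact le_top

/-- Quasiconcavity gives convexity, scale invariance gives homogeneity, and α(0) = ∞ puts 0 into
every level. -/
theorem IsAssessmentIndex.isL0Cone (hα : IsAssessmentIndex K α) (hscale : IsScaleInvariant α)
    (h0 : ∀ᵐ ω ∂P, α 0 ω = ⊤) (m : EL0 P) : IsL0Cone P {x | m ≤ α x} :=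
  IsL0Cone.of_convex (le_apply_zero h0 m)
    (fun x hx y hy lam hl => (le_inf hx hy).trans (hα.quasiconcave x y lam hl))
    (fun lam hl x hx => by
      change m ≤ α (lam • x)
      rw [hscale lam x hl]; exact hx)

variable [TopologicalSpace E]

theorem IsStableLocallyConvex.isTopologicalAddGroup (hE : IsStableLocallyConvex P E) :
    IsTopologicalAddGroup E where
  continuous_add := hE.continuous_add
  continuous_neg := by
    have := hE.continuous_smul.comp
      ((continuous_const (y := (-1 : L0 P))).prodMk (continuous_id (X := E)))
    simpa [Function.comp_def] using this

theorem IsStableLocallyConvex.continuous_smul_const (hE : IsStableLocallyConvex P E) (x : E) :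
    Continuous fun lam : L0 P => lam • x :=
  hE.continuous_smul.comp (continuous_id.prodMk continuous_const)

theorem IsStableLocallyConvex.continuous_const_smul (hE : IsStableLocallyConvex P E) (c : L0 P) :
    Continuous fun x : E => c • x :=
  hE.continuous_smul.comp (continuous_const.prodMk continuous_id)

/-- A linear functional bounded above on a balanced zero neighbourhood is continuous. -/
theorem IsStableLocallyConvex.continuous_of_le_one (hE : IsStableLocallyConvex P E)
    (f : E →ₗ[L0 P] L0 P) {U : Set E} (hU : U ∈ 𝓝 0) (hUb : L0Balanced P U)
    (hf : ∀ u ∈ U, f u ≤ 1) : Continuous f := by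
  have := hE.isTopologicalAddGroup
  refine continuous_of_continuousAt_zero f ?_
  intro V hV
  rw [map_zero] at hV
  obtain ⟨ε, hε, hV⟩ := mem_nhds_L0.1 hV
  obtain ⟨i, hi, h1⟩ := hε.exists_inv
  have hpre : (fun x : E => i • x) ⁻¹' U ∈ 𝓝 0 := by
    refine (hE.continuous_const_smul i).continuousAt.preimage_mem_nhds ?_
    rwa [smul_zero]
  refine mem_map.2 (mem_of_superset hpre fun x hx => hV _ ?_)
  have hx' : i • x ∈ U := hx
  have hx'' : -(i • x) ∈ U := by
    have := hUb _ hx' (-1) (by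
      filter_upwards [coe_neg (1 : L0 P), coe_one (P := P)] with ω h1 h2
      rw [h1, h2]; simp)
    rwa [neg_smul, one_smul] at this
  have e1 := mul_le_mul_of_nonneg_left (hf _ hx') hε.nonneg
  have e2 := mul_le_mul_of_nonneg_left (hf _ hx'') hε.nonneg
  rw [map_neg, mul_neg, map_smul, smul_eq_mul, ← mul_assoc, mul_comm ε i, h1, one_mul, mul_one]
    at e2
  rw [map_smul, smul_eq_mul, ← mul_assoc, mul_comm ε i, h1, one_mul, mul_one] at e1
  filter_upwards [le_iff.1 e1, le_iff.1 e2, coe_zero (P := P), coe_neg (f x)] with ω a1 a2 a3 a4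
  rw [a3, zero_sub, abs_neg, abs_le]
  rw [a4] at a2
  exact ⟨by linarith, a1⟩

theorem IsStableLocallyConvex.sigmaComplete (hE : IsStableLocallyConvex P E) {C : Set E}
    (hC : SigmaStable P C) : SigmaComplete P C := fun A hA x hx => by
  obtain ⟨y, hy⟩ := hE.exists_concat A hA x
  exact ⟨y, hC A hA x y hx hy, hy⟩

/-- Points outside a closed `σ`-stable cone are separated from it by a continuous functional. -/
theorem IsStableLocallyConvex.exists_dual_separation [IsFiniteMeasure P]
    (hE : IsStableLocallyConvex P E) {C : Set E} (hC : IsL0Cone P C) (hCs : SigmaStable P C)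
    (hCc : IsClosed C) {x : E} (hx : x ∉ C) : ∃ Z ∈ polar P C, ¬ 0 ≤ Z x := by
  have := hE.isTopologicalAddGroup
  have hW : {u : E | x - u ∉ C} ∈ 𝓝 0 := by
    -- Translating the open complement of C gives a neighbourhood of 0, and a good U inside it
    -- satisfies (x - C) ∩ U = ∅, as the algebraic separation demands.
    refine (hCc.isOpen_compl.preimage (continuous_const.sub continuous_id)).mem_nhds ?_
    simpa using hx
  obtain ⟨U, hU, hUW, hUc, hUa, hUb, hUs⟩ := hE.exists_base _ hW
  obtain ⟨f, hf, hf1, hfx⟩ := exists_separation hC (hE.sigmaComplete hCs) hUc hUa hUb hUs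
    (x₀ := x) (fun c hc hcon => hUW hcon (by simpa using hc))
  exact ⟨⟨f, hE.continuous_of_le_one f hU hUb hf1⟩, hf, hfx⟩

theorem eq_top_of_const_le {f : EL0 P} (h : ∀ n : ℕ, toE (AEEqFun.const Ω (n : ℝ)) ≤ f) :
    ∀ᵐ ω ∂P, f ω = ⊤ := by
  have hall : ∀ᵐ ω ∂P, ∀ n : ℕ, ((n : ℝ) : EReal) ≤ f ω := ae_all_iff.2 fun n => by
    filter_upwards [le_iff.1 (h n), coe_toE (AEEqFun.const Ω (n : ℝ) : L0 P),
      coe_const (P := P) (n : ℝ)] with ω h1 h2 h3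
    rwa [h2, h3] at h1
  filter_upwards [hall] with ω hω
  rw [EReal.eq_top_iff_forall_lt]
  intro y
  obtain ⟨n, hn⟩ := exists_nat_gt y
  exact lt_of_lt_of_le (EReal.coe_lt_coe_iff.2 hn) (hω n)

/-- Each closed level {α ≥ n} contains a whole open ray λx, λ > 0, hence also its endpoint 0. -/
theorem apply_zero_eq_top (hE : IsStableLocallyConvex P E) (husc : IsUSC α)
    (hscale : IsScaleInvariant α) (hne : ∀ m : L0 P, {x : E | toE m ≤ α x}.Nonempty) :
    ∀ᵐ ω ∂P, α 0 ω = ⊤ := by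
  refine eq_top_of_const_le fun n => ?_
  obtain ⟨x, hx⟩ := hne (AEEqFun.const Ω (n : ℝ))
  have := apply_zero_mem_of_isClosed (husc (toE (AEEqFun.const Ω (n : ℝ))))
    (hE.continuous_smul_const x) (fun lam hl => by
      change _ ≤ α (lam • x)
      rw [hscale lam x hl]; exact hx)
  rwa [zero_smul] at this

theorem smul_dual_apply (c : L0 P) (Z : Dual P E) (x : E) : (c • Z) x = c * Z x := rfl

theorem dual_congr_on {A : Set Ω} (hA : MeasurableSet A) {X Y : Dual P E}
    (h : indic P A hA • X = indic P A hA • Y) (x : E) : ∀ᵐ ω ∂P, ω ∈ A → X x ω = Y x ω := by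
  rw [← indic_mul_eq_iff hA, ← smul_dual_apply, h, smul_dual_apply]

theorem dual_apply_indic_smul {A : Set Ω} (hA : MeasurableSet A) (Z : Dual P E) (x : E) :
    ∀ᵐ ω ∂P, (ω ∈ A → Z (indic P A hA • x) ω = Z x ω) ∧
      (ω ∉ A → Z (indic P A hA • x) ω = 0) := by
  rw [map_smul, smul_eq_mul]
  filter_upwards [coe_indic (P := P) A hA, coe_mul (indic P A hA) (Z x)] with ω h1 h2
  rw [h2]
  exact ⟨fun h => by rw [h1.1 h, one_mul], fun h => by rw [h1.2 h, zero_mul]⟩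

/-- Turns a condition on acceptable y into a pointwise condition on all y: with B = {m ≤ α(y)},
locality and α(0) = ∞ make 1_B y acceptable. -/
theorem IsAssessmentIndex.smul_mem_levelPolar_iff (hα : IsAssessmentIndex K α)
    (h0 : ∀ᵐ ω ∂P, α 0 ω = ⊤) (Z : Dual P E) (m : EL0 P) :
    indic P {ω | m ω < ⊤} (measurableSet_lt_top m) • Z ∈ levelPolar α m ↔
      ∀ y, ∀ᵐ ω ∂P, m ω < ⊤ → m ω ≤ α y ω → 0 ≤ Z y ω := by
  constructor
  · intro h y
    have hB : MeasurableSet {ω | m ω ≤ α y ω} := measurableSet_le m.measurable (α y).measurable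
    have hy : m ≤ α (indic P _ hB • y) := by
      rw [hα.indic_smul, le_iff]
      filter_upwards [coe_glue _ hB (α y) (α 0), h0] with ω h1 h2
      by_cases hω : m ω ≤ α y ω
      · rw [h1.1 hω]; exact hω
      · rw [h1.2 hω, h2]; exact le_top
    have := h _ hy
    rw [smul_dual_apply] at this
    filter_upwards [le_iff.1 this, coe_mul (indic P _ (measurableSet_lt_top m))
      (Z (indic P _ hB • y)), coe_indic (P := P) _ (measurableSet_lt_top m),
      dual_apply_indic_smul hB Z y, coe_zero (P := P)] with ω h1 h2 h3 h4 h5 hω hω'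
    rwa [h5, h2, h3.1 hω, one_mul, h4.1 hω'] at h1
  · intro h y hy
    rw [smul_dual_apply, le_iff]
    filter_upwards [h y, le_iff.1 hy, coe_mul (indic P _ (measurableSet_lt_top m)) (Z y),
      coe_indic (P := P) _ (measurableSet_lt_top m), coe_zero (P := P)] with ω h1 h2 h3 h4 h5
    rw [h3, h5]
    by_cases hω : m ω < ⊤
    · rw [h4.1 hω, one_mul]; exact h1 hω h2
    · rw [h4.2 hω, zero_mul]

/-- The critical level of `Z` is the essential supremum of `α y` over `{⟨Z, y⟩ < 0}`. -/
theorem IsAssessmentIndex.criticalLevel_le_on [IsFiniteMeasure P] (hα : IsAssessmentIndex K α)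
    (h0 : ∀ᵐ ω ∂P, α 0 ω = ⊤) {Z : Dual P E} {m : EL0 P} {A : Set Ω} (hA : MeasurableSet A) :
    (∀ᵐ ω ∂P, ω ∈ A → criticalLevel α Z ω ≤ m ω) ↔
      ∀ y, ∀ᵐ ω ∂P, ω ∈ A → Z y ω < 0 → α y ω ≤ m ω := by
  constructor
  · intro h y
    have hB : MeasurableSet {ω | Z y ω < 0} := measurableSet_lt (Z y).measurable measurable_const
    have h1 : ∀ᵐ ω ∂P, ω ∈ {ω | Z y ω < 0} → α y ω ≤ criticalLevel α Z ω :=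
      (le_essinf_on hB).2 fun k hk => by
        filter_upwards [(hα.smul_mem_levelPolar_iff h0 Z k).1 hk y] with ω h2 hω
        by_contra hlt
        rw [not_le] at hlt
        exact absurd (h2 (lt_top_of_lt hlt) hlt.le) (not_le.2 hω)
    filter_upwards [h, h1] with ω h2 h3 hω hω'
    exact (h3 hω').trans (h2 hω)
  · intro h
    -- The level m itself need not be admissible, since α(y) = m may occur with ⟨Z, y⟩ < 0. Every
    -- rational q > m is: the level equal to q on A ∩ {m < q} and to ∞ elsewhere imposes no
    -- condition off that set.
    have hq : ∀ᵐ ω ∂P, ∀ q : ℚ, ω ∈ A → m ω < ((q : ℝ) : EReal) →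
        criticalLevel α Z ω ≤ ((q : ℝ) : EReal) := ae_all_iff.2 fun q => by
      have hB : MeasurableSet (A ∩ {ω | m ω < ((q : ℝ) : EReal)}) :=
        hA.inter (measurableSet_lt m.measurable measurable_const)
      have hle : criticalLevel α Z ≤ glue _ hB (AEEqFun.const Ω ((q : ℝ) : EReal))
          (AEEqFun.const Ω ⊤) := (isGLB_essinf _).1 <|
        (hα.smul_mem_levelPolar_iff h0 Z _).2 fun y => by
          filter_upwards [h y, coe_glue _ hB (AEEqFun.const Ω ((q : ℝ) : EReal))
            (AEEqFun.const Ω ⊤), coe_const (P := P) ((q : ℝ) : EReal),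
            coe_const (P := P) (⊤ : EReal)] with ω h1 h2 h3 h4 h5 h6
          by_cases hω : ω ∈ A ∩ {ω | m ω < ((q : ℝ) : EReal)}
          · rw [h2.1 hω, h3] at h6
            by_contra hlt
            exact absurd (lt_of_lt_of_le hω.2 h6) (not_lt.2 (h1 hω.1 (not_le.1 hlt)))
          · rw [h2.2 hω, h4] at h5
            exact absurd h5 (lt_irrefl _)
      filter_upwards [le_iff.1 hle, coe_glue _ hB (AEEqFun.const Ω ((q : ℝ) : EReal))
        (AEEqFun.const Ω ⊤), coe_const (P := P) ((q : ℝ) : EReal)] with ω h1 h2 h3 hω hlt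
      rwa [h2.1 ⟨hω, hlt⟩, h3] at h1
    filter_upwards [hq] with ω h1 hω
    by_contra hlt
    obtain ⟨q, hq1, hq2⟩ := EReal.exists_rat_btwn_of_lt (not_le.1 hlt)
    exact absurd (h1 q hω hq1) (not_le.2 hq2)

theorem IsAssessmentIndex.criticalLevel_le_iff [IsFiniteMeasure P] (hα : IsAssessmentIndex K α)
    (h0 : ∀ᵐ ω ∂P, α 0 ω = ⊤) {Z : Dual P E} {m : EL0 P} :
    criticalLevel α Z ≤ m ↔ ∀ y, ∀ᵐ ω ∂P, Z y ω < 0 → α y ω ≤ m ω := by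
  simpa [le_iff] using hα.criticalLevel_le_on h0 (Z := Z) (m := m) MeasurableSet.univ

theorem IsAssessmentIndex.le_criticalLevel [IsFiniteMeasure P] (hα : IsAssessmentIndex K α)
    (h0 : ∀ᵐ ω ∂P, α 0 ω = ⊤) (Z : Dual P E) (y : E) :
    ∀ᵐ ω ∂P, Z y ω < 0 → α y ω ≤ criticalLevel α Z ω :=
  (hα.criticalLevel_le_iff h0).1 le_rfl y

theorem IsAssessmentIndex.criticalLevel_congr_on [IsFiniteMeasure P] (hα : IsAssessmentIndex K α)
    (h0 : ∀ᵐ ω ∂P, α 0 ω = ⊤) {A : Set Ω} (hA : MeasurableSet A) {X Y : Dual P E}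
    (h : indic P A hA • X = indic P A hA • Y) :
    ∀ᵐ ω ∂P, ω ∈ A → criticalLevel α X ω = criticalLevel α Y ω := by
  have key : ∀ X Y : Dual P E, indic P A hA • X = indic P A hA • Y →
      ∀ᵐ ω ∂P, ω ∈ A → criticalLevel α X ω ≤ criticalLevel α Y ω := fun X Y h =>
    (hα.criticalLevel_le_on h0 hA).2 fun y => by
      filter_upwards [dual_congr_on hA h y, hα.le_criticalLevel h0 Y y] with ω h1 h2 hω hneg
      exact h2 (h1 hω ▸ hneg)
  filter_upwards [key X Y h, key Y X h.symm] with ω h1 h2 hω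
  exact le_antisymm (h1 hω) (h2 hω)

theorem coe_scaleRisk [IsFiniteMeasure P] (α : E → EL0 P) (Z : polar P K) (s : EL0 P) :
    ∀ᵐ ω ∂P, (s ω < 0 → scaleRisk K α Z s ω = criticalLevel α (Z : Dual P E) ω) ∧
      (¬ s ω < 0 → scaleRisk K α Z s ω = ⊤) := by
  filter_upwards [coe_glue _ (measurableSet_lt_zero s) (criticalLevel α (Z : Dual P E))
    (AEEqFun.const Ω ⊤), coe_const (P := P) (⊤ : EReal)] with ω h1 h2
  exact ⟨fun h => h1.1 h, fun h => (h1.2 h).trans h2⟩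

/-- The values of the left-continuous version at real arguments. -/
theorem leftVersion_le_iff [IsFiniteMeasure P] {R : EL0 P → EL0 P} (hR : Monotone R) (s : L0 P)
    (m : EL0 P) : leftVersion R (toE s) ≤ m ↔ ∀ ε : L0 P, Pos ε → R (toE (s - ε)) ≤ m := by
  have h1 : leftVersion R (toE s) ≤ m ↔
      esssup (R '' {n | ∀ᵐ ω ∂P, ⊥ < toE s ω → n ω < toE s ω}) ≤ m := by
    unfold leftVersion
    rw [le_iff, le_iff]
    refine ⟨fun h => ?_, fun h => ?_⟩ <;>
    · filter_upwards [h, coe_glue _ (measurableSet_bot_lt (toE s))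
        (esssup (R '' {n | ∀ᵐ ω ∂P, ⊥ < toE s ω → n ω < toE s ω})) (AEEqFun.const Ω ⊥),
        coe_toE s] with ω h1 h2 h3
      have hω : ω ∈ {ω | ⊥ < toE s ω} := by
        change ⊥ < toE s ω
        rw [h3]; exact EReal.bot_lt_coe _
      first
        | rwa [h2.1 hω] at h1
        | rwa [h2.1 hω]
  rw [h1, isLUB_le_iff (isLUB_esssup _), mem_upperBounds, forall_mem_image]
  constructor
  · intro h ε hε
    refine h ?_
    filter_upwards [hε, coe_toE s, coe_toE (s - ε), coe_sub s ε] with ω h1 h2 h3 h4 _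
    rw [h2, h3, h4, EReal.coe_lt_coe_iff]
    linarith
  · intro h n hn
    -- The choice ε = s - n recovers n exactly where n is finite; where n = -∞ monotonicity allows
    -- any ε.
    have hm : Measurable fun ω => if n ω = ⊥ then 1 else s ω - (n ω).toReal :=
      Measurable.ite (n.measurable (measurableSet_singleton ⊥)) measurable_const
        (s.measurable.sub n.measurable.ereal_toReal)
    have hlt : ∀ᵐ ω ∂P, n ω < (s ω : EReal) := by
      filter_upwards [hn, coe_toE s] with ω h1 h2
      rw [h2] at h1
      exact h1 (EReal.bot_lt_coe _)
    refine le_trans (hR (le_iff.2 ?_)) (h (AEEqFun.mk _ hm.aestronglyMeasurable) ?_)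
    · filter_upwards [hlt, coe_mk (P := P) hm, coe_sub s (AEEqFun.mk _ hm.aestronglyMeasurable),
        coe_toE (s - AEEqFun.mk _ hm.aestronglyMeasurable)] with ω h1 h2 h3 h4
      rw [h4, h3, h2]
      split_ifs with hb
      · rw [hb]; exact bot_le
      · rw [sub_sub_cancel, EReal.coe_toReal (ne_top_of_lt h1) hb]
    · filter_upwards [hlt, coe_mk (P := P) hm] with ω h1 h2
      rw [h2]
      split_ifs with hb
      · exact one_pos
      · rw [← EReal.coe_toReal (ne_top_of_lt h1) hb, EReal.coe_lt_coe_iff] at h1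
        exact sub_pos.2 h1

end Index

/-! ### R_α is a minimal risk function and represents α. -/

section ScaleRisk

variable {Ω : Type*} [MeasurableSpace Ω] {P : Measure Ω}
  {E : Type*} [AddCommGroup E] [Module (L0 P) E] [TopologicalSpace E] {K : Set E} {α : E → EL0 P}

/-- The map `(Z, s) ↦ ((⟨Z, x⟩)ₓ, s)`, which induces the weak topology on `K° × L⁰`. -/
noncomputable def weakMap (K : Set E) (p : polar P K × L0 P) : (E → L0 P) × L0 P :=
  (fun x : E => (p.1 : Dual P E) x, p.2)

/-- The topology on `K° × L⁰`: the weak topology on `K°` times the topology of `L⁰`. -/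
noncomputable abbrev weakTopology (K : Set E) : TopologicalSpace (polar P K × L0 P) :=
  TopologicalSpace.induced (weakMap K) inferInstance

theorem weakTopology_continuous_apply (x : E) :
    Continuous[weakTopology K, _] fun p : polar P K × L0 P => (p.1 : Dual P E) x := by
  let _ := weakTopology (P := P) K
  have h : Continuous fun z : (E → L0 P) × L0 P => z.1 x :=
    (continuous_apply x).comp continuous_fst
  exact h.comp (continuous_induced_dom (f := weakMap (P := P) K))

theorem weakTopology_continuous_snd :
    Continuous[weakTopology K, _] fun p : polar P K × L0 P => p.2 := by
  let _ := weakTopology (P := P) K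
  have h : Continuous fun z : (E → L0 P) × L0 P => z.2 := continuous_snd
  exact h.comp (continuous_induced_dom (f := weakMap (P := P) K))

theorem indic_smul_eq_of_eq_add {M : Type*} [AddCommGroup M] [Module (L0 P) M] {A : Set Ω}
    (hA : MeasurableSet A) {X Y Z : M}
    (h : Z = indic P A hA • X + indic P Aᶜ hA.compl • Y) :
    indic P A hA • Z = indic P A hA • X ∧
      indic P Aᶜ hA.compl • Z = indic P Aᶜ hA.compl • Y := by
  subst h
  constructor
  · rw [smul_add, smul_smul, smul_smul, indic_mul_self, indic_mul_compl, zero_smul, add_zero]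
  · rw [smul_add, smul_smul, smul_smul, indic_mul_self, mul_comm, indic_mul_compl, zero_smul,
      zero_add]

theorem pos_abs_add_one (s : L0 P) : ∃ ε : L0 P, Pos ε ∧ ∀ᵐ ω ∂P, (s - ε) ω < 0 := by
  have hm : Measurable fun ω => |s ω| + 1 := s.measurable.norm.add_const 1
  refine ⟨AEEqFun.mk _ hm.aestronglyMeasurable, ?_, ?_⟩
  · filter_upwards [coe_mk (P := P) hm] with ω h
    rw [h]; positivity
  · filter_upwards [coe_mk (P := P) hm, coe_sub s (AEEqFun.mk _ hm.aestronglyMeasurable)]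
      with ω h1 h2
    rw [h2, h1]
    linarith [le_abs_self (s ω)]

theorem scaleRisk_monotone [IsFiniteMeasure P] (Z : polar P K) :
    Monotone (scaleRisk K α Z) := fun s t hst => by
  rw [le_iff]
  filter_upwards [coe_scaleRisk α Z s, coe_scaleRisk α Z t, le_iff.1 hst] with ω h1 h2 h3
  by_cases ht : t ω < 0
  · rw [h1.1 (h3.trans_lt ht), h2.1 ht]
  · rw [h2.2 ht]; exact le_top

theorem scaleRisk_rightContinuous [IsFiniteMeasure P] (Z : polar P K) (s : EL0 P) :
    scaleRisk K α Z s = rightVersion (scaleRisk K α Z) s := by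
  set S := scaleRisk K α Z '' {n | ∀ᵐ ω ∂P, s ω < ⊤ → s ω < n ω}
  have hlow : ∀ᵐ ω ∂P, ω ∈ {ω | s ω < ⊤} → scaleRisk K α Z s ω ≤ essinf S ω :=
    (le_essinf_on (measurableSet_lt_top s)).2 <| by
      rintro _ ⟨n, hn, rfl⟩
      filter_upwards [coe_scaleRisk α Z s, coe_scaleRisk α Z n, hn] with ω h1 h2 h3 hω
      by_cases ht : n ω < 0
      · rw [h1.1 ((h3 hω).trans ht), h2.1 ht]
      · rw [h2.2 ht]; exact le_top
  -- On {s < 0} a rational between s and 0 is an argument beyond s at which R_α still has its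
  -- constant value.
  have hup : ∀ᵐ ω ∂P, ∀ q : ℚ, (q : ℝ) < 0 → s ω < ((q : ℝ) : EReal) →
      essinf S ω ≤ scaleRisk K α Z s ω := ae_all_iff.2 fun q => by
    by_cases hq : (q : ℝ) < 0
    · have hB : MeasurableSet {ω | s ω < ((q : ℝ) : EReal)} :=
        measurableSet_lt s.measurable measurable_const
      have hmem : scaleRisk K α Z (glue _ hB (AEEqFun.const Ω ((q : ℝ) : EReal))
          (AEEqFun.const Ω ⊤)) ∈ S := mem_image_of_mem _ <| by
        filter_upwards [coe_glue _ hB (AEEqFun.const Ω ((q : ℝ) : EReal))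
          (AEEqFun.const Ω ⊤), coe_const (P := P) ((q : ℝ) : EReal),
          coe_const (P := P) (⊤ : EReal)] with ω h1 h2 h3 hω
        by_cases h : ω ∈ {ω | s ω < ((q : ℝ) : EReal)}
        · rw [h1.1 h, h2]; exact h
        · rw [h1.2 h, h3]; exact hω
      filter_upwards [le_iff.1 ((isGLB_essinf S).1 hmem), coe_scaleRisk α Z s,
        coe_scaleRisk α Z (glue _ hB (AEEqFun.const Ω ((q : ℝ) : EReal)) (AEEqFun.const Ω ⊤)),
        coe_glue _ hB (AEEqFun.const Ω ((q : ℝ) : EReal)) (AEEqFun.const Ω ⊤),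
        coe_const (P := P) ((q : ℝ) : EReal)] with ω h1 h2 h3 h4 h5 _ hω
      have hq' : ((q : ℝ) : EReal) < 0 := by exact_mod_cast hq
      rw [h3.1 (by rw [h4.1 hω, h5]; exact hq')] at h1
      rwa [h2.1 (lt_trans hω hq')]
    · exact Eventually.of_forall fun ω h => absurd h hq
  refine AEEqFun.ext ?_
  unfold rightVersion
  filter_upwards [hlow, hup, coe_scaleRisk α Z s, coe_const (P := P) (⊤ : EReal),
    coe_glue _ (measurableSet_lt_top s) (essinf S) (AEEqFun.const Ω ⊤)] with ω h1 h2 h3 h4 h5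
  by_cases hω : ω ∈ {ω | s ω < ⊤}
  · rw [h5.1 hω]
    refine le_antisymm (h1 hω) ?_
    by_cases hneg : s ω < 0
    · obtain ⟨q, hq1, hq2⟩ := EReal.exists_rat_btwn_of_lt hneg
      exact h2 q (by exact_mod_cast hq2) hq1
    · rw [h3.2 hneg]; exact le_top
  · rw [h5.2 hω, h4]
    refine h3.2 fun hneg => hω ?_
    exact lt_of_lt_of_le hneg le_top

/-- The left-continuous version moves the jump point 0 to the finite side: it equals the critical
level on {s ≤ 0} and ∞ on {s > 0}. -/
theorem leftVersion_scaleRisk_le_iff [IsFiniteMeasure P] (Z : polar P K) (s : L0 P) (m : EL0 P) :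
    leftVersion (scaleRisk K α Z) (toE s) ≤ m ↔
      criticalLevel α (Z : Dual P E) ≤ m ∧ ∀ᵐ ω ∂P, m ω < ⊤ → s ω ≤ 0 := by
  rw [leftVersion_le_iff (scaleRisk_monotone Z)]
  constructor
  · intro h
    constructor
    · obtain ⟨ε, hε, hneg⟩ := pos_abs_add_one s
      rw [le_iff]
      filter_upwards [hneg, le_iff.1 (h ε hε), coe_scaleRisk α Z (toE (s - ε)), coe_toE (s - ε)]
        with ω h1 h2 h3 h4
      rwa [h3.1 (by rw [h4]; exact_mod_cast h1)] at h2
    · have hB : MeasurableSet {ω | 0 < s ω} := measurableSet_lt measurable_const s.measurable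
      -- With ε = s on {s > 0}, the argument s - ε is exactly 0 there, where R_α is already ∞.
      have hε : Pos (glue _ hB s 1) := by
        filter_upwards [coe_glue _ hB s 1, coe_one (P := P)] with ω h1 h2
        by_cases hω : ω ∈ {ω | 0 < s ω}
        · rw [h1.1 hω]; exact hω
        · rw [h1.2 hω, h2]; exact one_pos
      filter_upwards [le_iff.1 (h _ hε), coe_scaleRisk α Z (toE (s - glue _ hB s 1)),
        coe_toE (s - glue _ hB s 1), coe_sub s (glue _ hB s 1), coe_glue _ hB s 1]
        with ω h1 h2 h3 h4 h5 hm
      by_contra hs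
      rw [h2.2 (by rw [h3, h4, h5.1 (not_le.1 hs)]; simp)] at h1
      exact absurd hm (not_lt.2 h1)
  · rintro ⟨h1, h2⟩ ε hε
    rw [le_iff]
    filter_upwards [le_iff.1 h1, h2, hε, coe_scaleRisk α Z (toE (s - ε)), coe_toE (s - ε),
      coe_sub s ε] with ω a1 a2 a3 a4 a5 a6
    by_cases hω : toE (s - ε) ω < 0
    · rw [a4.1 hω]; exact a1
    · rw [a5, a6] at hω
      by_contra hlt
      have h3 := a2 (lt_of_lt_of_le (not_le.1 hlt) le_top)
      refine hω ?_
      exact_mod_cast (by linarith : s ω - ε ω < 0)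

/-- The sublevel set is cut out by sign conditions: ⟨Z, y⟩ ≥ 0 on {m < α(y)} for every y, and s ≤ 0
on {m < ∞}. Each is closed for the weak topology. -/
theorem scaleRisk_left_lsc [IsFiniteMeasure P] (hα : IsAssessmentIndex K α)
    (h0 : ∀ᵐ ω ∂P, α 0 ω = ⊤) (m : EL0 P) :
    IsClosed[weakTopology K]
      {p : polar P K × L0 P | leftVersion (scaleRisk K α p.1) (toE p.2) ≤ m} := by
  let _ := weakTopology (P := P) K
  have heq : {p : polar P K × L0 P | leftVersion (scaleRisk K α p.1) (toE p.2) ≤ m} =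
      (⋂ y, (fun p : polar P K × L0 P => (p.1 : Dual P E) y) ⁻¹'
        {z | ∀ᵐ ω ∂P, ω ∈ {ω | m ω < α y ω} → 0 ≤ z ω}) ∩
      (fun p : polar P K × L0 P => -p.2) ⁻¹' {z | ∀ᵐ ω ∂P, ω ∈ {ω | m ω < ⊤} → 0 ≤ z ω} := by
    ext p
    simp only [mem_ofPred_eq, mem_inter_iff, mem_iInter, mem_preimage,
      leftVersion_scaleRisk_le_iff, hα.criticalLevel_le_iff h0]
    refine and_congr (forall_congr' fun y => ?_) ?_
    · refine eventually_congr (Eventually.of_forall fun ω => ?_)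
      rw [← not_le, ← not_le, not_imp_comm, not_le]
    · refine eventually_congr ?_
      filter_upwards [coe_neg p.2] with ω h
      rw [h, neg_nonneg]
  rw [heq]
  exact (isClosed_iInter fun y => (isClosed_nonneg_on _).preimage
    (weakTopology_continuous_apply y)).inter
    ((isClosed_nonneg_on _).preimage weakTopology_continuous_snd.neg)

theorem scaleRisk_jointly_local [IsFiniteMeasure P] (hα : IsAssessmentIndex K α)
    (h0 : ∀ᵐ ω ∂P, α 0 ω = ⊤) (A : Set Ω) (hA : MeasurableSet A) (X Y Z : polar P K)
    (s t : EL0 P)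
    (hZ : (Z : Dual P E) = indic P A hA • (X : Dual P E) + indic P Aᶜ hA.compl • (Y : Dual P E)) :
    scaleRisk K α Z (glue A hA s t) = glue A hA (scaleRisk K α X s) (scaleRisk K α Y t) := by
  obtain ⟨hX, hY⟩ := indic_smul_eq_of_eq_add hA hZ
  refine AEEqFun.ext ?_
  filter_upwards [hα.criticalLevel_congr_on h0 hA hX, hα.criticalLevel_congr_on h0 hA.compl hY,
    coe_glue A hA s t, coe_glue A hA (scaleRisk K α X s) (scaleRisk K α Y t),
    coe_scaleRisk α Z (glue A hA s t), coe_scaleRisk α X s, coe_scaleRisk α Y t]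
    with ω h1 h2 h3 h4 h5 h6 h7
  by_cases hω : ω ∈ A
  · rw [h4.1 hω]
    rw [h3.1 hω] at h5
    by_cases hs : s ω < 0
    · rw [h5.1 hs, h6.1 hs, h1 hω]
    · rw [h5.2 hs, h6.2 hs]
  · rw [h4.2 hω]
    rw [h3.2 hω] at h5
    by_cases hs : t ω < 0
    · rw [h5.1 hs, h7.1 hs, h2 hω]
    · rw [h5.2 hs, h7.2 hs]

theorem mix_neg {l : ℝ} (hl : 0 ≤ l ∧ l ≤ 1) {s t : EReal} (hs : s < 0) (ht : t < 0) :
    (l : EReal) * s + ((1 - l : ℝ) : EReal) * t < 0 := by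
  have aux : ∀ {c : ℝ} {u : EReal}, 0 ≤ c → u < 0 → (c : EReal) * u ≤ 0 := fun hc hu =>
    EReal.mul_nonpos_iff.2 (Or.inl ⟨by exact_mod_cast hc, hu.le⟩)
  have aux' : ∀ {c : ℝ} {u : EReal}, 0 < c → u < 0 → (c : EReal) * u < 0 := fun hc hu =>
    EReal.mul_neg_iff.2 (Or.inl ⟨by exact_mod_cast hc, hu⟩)
  have h1 := aux hl.1 hs
  have h2 := aux (sub_nonneg.2 hl.2) ht
  rcases eq_or_lt_of_le hl.1 with h | h
  · subst h; simpa using ht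
  · exact (add_le_of_nonpos_right h2).trans_lt (aux' h hs)

/-- A convex combination of ⟨X, y⟩ and ⟨Y, y⟩ is negative only where one of them is, so its critical
level is at most the larger one. Where s or t is nonnegative the right-hand side is ∞. -/
theorem scaleRisk_jointly_quasiconvex [IsFiniteMeasure P] (hα : IsAssessmentIndex K α)
    (h0 : ∀ᵐ ω ∂P, α 0 ω = ⊤) (X Y Z : polar P K) (s t : EL0 P) (lam : L0 P)
    (hl : UnitInterval lam)
    (hZ : (Z : Dual P E) = lam • (X : Dual P E) + (1 - lam) • (Y : Dual P E)) :
    scaleRisk K α Z (mix lam s t) ≤ scaleRisk K α X s ⊔ scaleRisk K α Y t := by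
  have hcrit : criticalLevel α (Z : Dual P E) ≤
      criticalLevel α (X : Dual P E) ⊔ criticalLevel α (Y : Dual P E) := by
    refine (hα.criticalLevel_le_iff h0).2 fun y => ?_
    have hZy : (Z : Dual P E) y = lam * (X : Dual P E) y + (1 - lam) * (Y : Dual P E) y := by
      rw [hZ]; rfl
    rw [hZy]
    filter_upwards [hα.le_criticalLevel h0 X y, hα.le_criticalLevel h0 Y y, hl,
      coe_add (lam * (X : Dual P E) y) ((1 - lam) * (Y : Dual P E) y),
      coe_mul lam ((X : Dual P E) y), coe_mul (1 - lam) ((Y : Dual P E) y), coe_sub 1 lam,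
      coe_one (P := P), AEEqFun.coeFn_sup (criticalLevel α (X : Dual P E))
        (criticalLevel α (Y : Dual P E))] with ω h1 h2 h3 h4 h5 h6 h7 h8 h9 hneg
    rw [h4, h5, h6, h7, h8] at hneg
    rw [h9]
    by_cases hX : (X : Dual P E) y ω < 0
    · exact (h1 hX).trans le_sup_left
    · by_cases hY : (Y : Dual P E) y ω < 0
      · exact (h2 hY).trans le_sup_right
      · exfalso
        have e1 := mul_nonneg h3.1 (not_lt.1 hX)
        have e2 := mul_nonneg (sub_nonneg.2 h3.2) (not_lt.1 hY)
        linarith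
  rw [le_iff]
  filter_upwards [le_iff.1 hcrit, hl, coe_mix lam s t, coe_scaleRisk α Z (mix lam s t),
    coe_scaleRisk α X s, coe_scaleRisk α Y t, AEEqFun.coeFn_sup (criticalLevel α (X : Dual P E))
    (criticalLevel α (Y : Dual P E)), AEEqFun.coeFn_sup (scaleRisk K α X s) (scaleRisk K α Y t)]
    with ω h1 h2 h3 h4 h5 h6 h7 h8
  rw [h8]
  by_cases hs : s ω < 0
  · by_cases ht : t ω < 0
    · rw [h5.1 hs, h6.1 ht, ← h7, h4.1 (by rw [h3]; exact mix_neg h2 hs ht)]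
      exact h1
    · rw [h6.2 ht, sup_top_eq]; exact le_top
  · rw [h5.2 hs, top_sup_eq]; exact le_top

theorem scaleRisk_scaling [IsFiniteMeasure P] (hα : IsAssessmentIndex K α)
    (h0 : ∀ᵐ ω ∂P, α 0 ω = ⊤) (X Z : polar P K) (s : EL0 P) (lam : L0 P) (hl : Pos lam)
    (hZ : (Z : Dual P E) = lam • (X : Dual P E)) :
    scaleRisk K α Z s = scaleRisk K α X (divE s lam) := by
  have key : ∀ (X Z : Dual P E) (lam : L0 P), Pos lam → Z = lam • X →
      criticalLevel α Z ≤ criticalLevel α X := fun X Z lam hl hZ =>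
    (hα.criticalLevel_le_iff h0).2 fun y => by
      rw [hZ, smul_dual_apply]
      filter_upwards [hα.le_criticalLevel h0 X y, hl, coe_mul lam (X y)] with ω h1 h2 h3 hneg
      rw [h3] at hneg
      exact h1 (neg_of_mul_neg_right hneg h2.le)
  have hcrit : criticalLevel α (Z : Dual P E) = criticalLevel α (X : Dual P E) := by
    obtain ⟨i, hi, h1⟩ := hl.exists_inv
    exact le_antisymm (key _ _ lam hl hZ) (key _ _ i hi (by rw [hZ, smul_smul, h1, one_smul]))
  refine AEEqFun.ext ?_
  filter_upwards [coe_scaleRisk α Z s, coe_scaleRisk α X (divE s lam), coe_divE s lam, hl]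
    with ω h1 h2 h3 h4
  have hiff : divE s lam ω < 0 ↔ s ω < 0 := by
    have hpos : (0 : EReal) < (((lam ω)⁻¹ : ℝ) : EReal) := by exact_mod_cast inv_pos.2 h4
    rw [h3, EReal.mul_neg_iff]
    constructor
    · rintro (h | h)
      · exact h.2
      · exact absurd h.1 (not_lt.2 hpos.le)
    · exact fun h => Or.inl ⟨hpos, h⟩
  rw [hiff] at h2
  by_cases hs : s ω < 0
  · rw [h1.1 hs, h2.1 hs, hcrit]
  · rw [h1.2 hs, h2.2 hs]

theorem esssup_scaleRisk [IsFiniteMeasure P] (X : polar P K) :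
    ∀ᵐ ω ∂P, esssup (range fun s : L0 P => scaleRisk K α X (toE s)) ω = ⊤ := by
  filter_upwards [le_iff.1 ((isLUB_esssup (range fun s : L0 P => scaleRisk K α X (toE s))).1
    (mem_range_self 0)), coe_scaleRisk α X (toE 0), coe_toE (0 : L0 P), coe_zero (P := P)]
    with ω h1 h2 h3 h4
  rw [h2.2 (by rw [h3, h4]; simp)] at h1
  exact top_le_iff.1 h1

theorem isMinimalRiskFunction_scaleRisk [IsFiniteMeasure P] (hα : IsAssessmentIndex K α)
    (h0 : ∀ᵐ ω ∂P, α 0 ω = ⊤) : IsMinimalRiskFunction (scaleRisk K α) where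
  jointly_local := scaleRisk_jointly_local hα h0
  increasing := scaleRisk_monotone
  rightContinuous := scaleRisk_rightContinuous
  jointly_quasiconvex := scaleRisk_jointly_quasiconvex hα h0
  scaling := scaleRisk_scaling hα h0
  asymptotic_max X Y := AEEqFun.ext <| by
    filter_upwards [esssup_scaleRisk (α := α) X, esssup_scaleRisk (α := α) Y] with ω h1 h2
    rw [h1, h2]
  left_lsc := scaleRisk_left_lsc hα h0

theorem represents_scaleRisk [IsFiniteMeasure P] (hE : IsStableLocallyConvex P E)
    (hα : IsAssessmentIndex K α) (husc : IsUSC α) (hscale : IsScaleInvariant α)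
    (h0 : ∀ᵐ ω ∂P, α 0 ω = ⊤) : Represents (scaleRisk K α) α := by
  intro x
  have hglb := isGLB_essinf (range fun Z : polar P K =>
    scaleRisk K α Z (toE ((Z : Dual P E) x)))
  set h := essinf (range fun Z : polar P K => scaleRisk K α Z (toE ((Z : Dual P E) x)))
  refine le_antisymm (hglb.2 ?_) ?_
  · rintro _ ⟨Z, rfl⟩
    rw [le_iff]
    filter_upwards [hα.le_criticalLevel h0 Z x, coe_scaleRisk α Z (toE ((Z : Dual P E) x)),
      coe_toE ((Z : Dual P E) x)] with ω h1 h2 h3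
    by_cases hneg : (Z : Dual P E) x ω < 0
    · rw [h2.1 (by rw [h3]; exact_mod_cast hneg)]; exact h1 hneg
    · rw [h2.2 (by rw [h3]; exact_mod_cast hneg)]; exact le_top
  · have hq : ∀ᵐ ω ∂P, ∀ q : ℚ, ¬ (α x ω < ((q : ℝ) : EReal) ∧ ((q : ℝ) : EReal) < h ω) := by
      refine ae_all_iff.2 fun q => ?_
      by_contra hcon
      have hA : MeasurableSet {ω | α x ω < ((q : ℝ) : EReal) ∧ ((q : ℝ) : EReal) < h ω} :=
        (measurableSet_lt (α x).measurable measurable_const).inter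
          (measurableSet_lt measurable_const h.measurable)
      set A := {ω | α x ω < ((q : ℝ) : EReal) ∧ ((q : ℝ) : EReal) < h ω}
      let m : EL0 P := AEEqFun.const Ω ((q : ℝ) : EReal)
      have hx : indic P A hA • x ∉ {x | m ≤ α x} := fun hx => hcon <| by
        have hx' : m ≤ α (indic P A hA • x) := hx
        rw [hα.indic_smul] at hx'
        filter_upwards [le_iff.1 hx', coe_glue A hA (α x) (α 0),
          coe_const (P := P) ((q : ℝ) : EReal)] with ω h1 h2 h3 hω
        rw [h2.1 hω, h3] at h1
        exact absurd hω.1 (not_lt.2 h1)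
      -- Cutting x down to A makes ⟨Z, 1_A x⟩ vanish off A, so the failure of nonnegativity takes
      -- place inside A.
      obtain ⟨Z, hZ, hZx⟩ := hE.exists_dual_separation (hα.isL0Cone hscale h0 m)
        (hα.sigmaStable m) (husc m) hx
      have hZK : Z ∈ polar P K := fun y hy => hZ y <|
        (le_apply_zero h0 m).trans (hα.monotone y 0 (by rwa [sub_zero]))
      have hcrit : criticalLevel α Z ≤ m := (isGLB_essinf _).1 fun y hy => by
        rw [smul_dual_apply]
        exact mul_nonneg (indic_nonneg _ _) (hZ y hy)
      refine hZx (le_iff.2 ?_)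
      filter_upwards [le_iff.1 hcrit, dual_apply_indic_smul hA Z x, coe_zero (P := P),
        le_iff.1 (hglb.1 (mem_range_self ⟨Z, hZK⟩)), coe_const (P := P) ((q : ℝ) : EReal),
        coe_scaleRisk α (⟨Z, hZK⟩ : polar P K) (toE (Z x)), coe_toE (Z x)]
        with ω h1 h2 h3 h4 h5 h6 h7
      rw [h3]
      by_cases hω : ω ∈ A
      · rw [h2.1 hω]
        by_contra hneg
        have h8 : h ω ≤ criticalLevel α Z ω :=
          h4.trans (h6.1 (by rw [h7]; exact_mod_cast not_le.1 hneg)).le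
        rw [h5] at h1
        exact absurd hω.2 (not_lt.2 (h8.trans h1))
      · rw [h2.2 hω]
    rw [le_iff]
    filter_upwards [hq] with ω hω
    by_contra hlt
    obtain ⟨q, hq1, hq2⟩ := EReal.exists_rat_btwn_of_lt (not_le.1 hlt)
    exact hω q ⟨hq1, hq2⟩

end ScaleRisk

/-! ### Concatenated functionals and separation in the weak topology. -/

section WeakSeparation

variable {Ω : Type*} [MeasurableSpace Ω] {P : Measure Ω}

theorem IsPartition.ae_of_forall {A : ℕ → Set Ω} (hA : IsPartition A) {p : Ω → Prop}
    (h : ∀ i, ∀ᵐ ω ∂P, ω ∈ A i → p ω) : ∀ᵐ ω ∂P, p ω := by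
  filter_upwards [ae_all_iff.2 h] with ω hω
  obtain ⟨i, hi⟩ := mem_iUnion.1 (hA.cover ▸ mem_univ ω : ω ∈ ⋃ i, A i)
  exact hω i hi

theorem exists_concat_L0 {A : ℕ → Set Ω} (hA : IsPartition A) (a : ℕ → L0 P) :
    ∃ c : L0 P, ∀ i, ∀ᵐ ω ∂P, ω ∈ A i → c ω = a i ω := by
  obtain ⟨f, hf, hfa⟩ := exists_measurable_piecewise A hA.measurable (fun i => (a i : Ω → ℝ))
    (fun i => (a i).measurable) (fun i j hij ω hω =>
      absurd hω.2 (disjoint_left.1 (hA.disjoint hij) hω.1))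
  refine ⟨AEEqFun.mk f hf.aestronglyMeasurable, fun i => ?_⟩
  filter_upwards [coe_mk (P := P) hf] with ω h hω
  rw [h]; exact hfa i hω

/-- The unit box of `(L⁰)^ι`. -/
def unitBox (P : Measure Ω) (ι : Type*) : Set (ι → L0 P) := {y | ∀ j, ∀ᵐ ω ∂P, |y j ω| ≤ 1}

theorem l0Convex_unitBox {ι : Type*} : L0Convex P (unitBox P ι) := by
  intro y hy z hz lam hl j
  filter_upwards [hy j, hz j, hl, coe_add (lam * y j) ((1 - lam) * z j), coe_mul lam (y j),
    coe_mul (1 - lam) (z j), coe_sub 1 lam, coe_one (P := P)] with ω h1 h2 h3 h4 h5 h6 h7 h8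
  change |(lam * y j + (1 - lam) * z j) ω| ≤ 1
  rw [h4, h5, h6, h7, h8]
  rw [abs_le] at *
  constructor <;> nlinarith

theorem l0Absorbent_unitBox {ι : Type*} [Fintype ι] : L0Absorbent P (unitBox P ι) := by
  intro y
  have hm : Measurable fun ω => 1 + ∑ j, |y j ω| :=
    (Finset.measurable_sum _ fun j _ => (y j).measurable.norm).const_add 1
  have hpos : Pos (AEEqFun.mk _ hm.aestronglyMeasurable : L0 P) := by
    filter_upwards [coe_mk (P := P) hm] with ω h
    rw [h]; positivity
  obtain ⟨i, hi, h1⟩ := hpos.exists_inv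
  refine ⟨_, hpos, i • y, fun j => ?_, by rw [smul_smul, mul_comm, h1, one_smul]⟩
  have h1' : ∀ᵐ ω ∂P, (i * AEEqFun.mk _ hm.aestronglyMeasurable : L0 P) ω = 1 := h1 ▸ coe_one
  filter_upwards [hi, h1', coe_mul i (AEEqFun.mk _ hm.aestronglyMeasurable), coe_mk (P := P) hm,
    coe_mul i (y j)] with ω h2 h3 h4 h5 h6
  change |(i * y j) ω| ≤ 1
  rw [h4, h5] at h3
  rw [h6, abs_mul, abs_of_pos h2, ← h3]
  have : |y j ω| ≤ ∑ j, |y j ω| :=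
    Finset.single_le_sum (f := fun j => |y j ω|) (fun _ _ => abs_nonneg _) (Finset.mem_univ j)
  gcongr
  linarith

theorem l0Balanced_unitBox {ι : Type*} : L0Balanced P (unitBox P ι) := by
  intro y hy lam hl j
  filter_upwards [hy j, hl, coe_mul lam (y j)] with ω h1 h2 h3
  change |(lam * y j) ω| ≤ 1
  rw [h3, abs_mul]
  exact mul_le_one₀ h2 (abs_nonneg _) h1

theorem sigmaStable_unitBox {ι : Type*} : SigmaStable P (unitBox P ι) := by
  intro A hA x y hx hy j
  refine hA.ae_of_forall fun i => ?_
  filter_upwards [(indic_mul_eq_iff (hA.measurable i)).1 (congrFun (hy i) j), hx i j]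
    with ω h1 h2 hω
  rw [h1 hω]; exact h2

section Image

variable {F G : Type*} [AddCommGroup F] [Module (L0 P) F] [AddCommGroup G] [Module (L0 P) G]
  {C : Set F}

theorem IsL0Cone.image (hC : IsL0Cone P C) (T : F →ₗ[L0 P] G) : IsL0Cone P (T '' C) where
  zero_mem := ⟨0, hC.zero_mem, map_zero T⟩
  add_mem := by
    rintro _ ⟨x, hx, rfl⟩ _ ⟨y, hy, rfl⟩
    exact ⟨x + y, hC.add_mem x hx y hy, map_add T x y⟩
  smul_mem := by
    rintro lam hl _ ⟨x, hx, rfl⟩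
    exact ⟨lam • x, hC.smul_mem lam hl x hx, map_smul T lam x⟩

/-- Mere existence of a concatenation inside C survives linear images; this is why the separation
theorem assumes it of the cone. -/
theorem SigmaComplete.image (hC : SigmaComplete P C) (T : F →ₗ[L0 P] G) :
    SigmaComplete P (T '' C) := by
  intro A hA x hx
  choose u hu hux using hx
  obtain ⟨y, hy, hyc⟩ := hC A hA u hu
  refine ⟨T y, ⟨y, hy, rfl⟩, fun i => ?_⟩
  rw [← hux i, ← map_smul, hyc i, map_smul]

end Image

variable {E : Type*} [AddCommGroup E] [Module (L0 P) E] [TopologicalSpace E] {K : Set E}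

/-- Countable concatenations of continuous functionals. -/
theorem IsStableLocallyConvex.exists_dual_concat (hE : IsStableLocallyConvex P E)
    {A : ℕ → Set Ω} (hA : IsPartition A) (Z : ℕ → Dual P E) :
    ∃ Y : Dual P E, ∀ i x, ∀ᵐ ω ∂P, ω ∈ A i → Y x ω = Z i x ω := by
  choose f hf using fun x => exists_concat_L0 hA fun i => Z i x
  let g : E →ₗ[L0 P] L0 P :=
    { toFun := f
      map_add' := fun x y => AEEqFun.ext <| hA.ae_of_forall fun i => by
        filter_upwards [hf x i, hf y i, hf (x + y) i, coe_add (f x) (f y),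
          coe_add (Z i x) (Z i y)] with ω h1 h2 h3 h4 h5 hω
        rw [h3 hω, h4, h1 hω, h2 hω, map_add, h5]
      map_smul' := fun c x => AEEqFun.ext <| hA.ae_of_forall fun i => by
        filter_upwards [hf x i, hf (c • x) i, coe_mul c (f x), coe_mul c (Z i x)]
          with ω h1 h2 h3 h4 hω
        rw [h2 hω, map_smul, smul_eq_mul, h4]
        change _ = (c * f x) ω
        rw [h3, h1 hω] }
  have := hE.isTopologicalAddGroup
  refine ⟨⟨g, continuous_of_continuousAt_zero g fun V hV => ?_⟩, fun i x => hf x i⟩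
  rw [map_zero] at hV
  obtain ⟨ε, hε, hV⟩ := mem_nhds_L0.1 hV
  have hU : ∀ i, {x | ∀ᵐ ω ∂P, |(0 : L0 P) ω - Z i x ω| ≤ ε ω} ∈ 𝓝 (0 : E) := fun i => by
    have := (Z i).continuous.continuousAt.preimage_mem_nhds (x := 0)
      (by rw [map_zero]; exact ball_mem_nhds 0 hε)
    exact this
  -- Stability of the topology gives continuity: the concatenation of the sets {|Z_i| ≤ ε}, with a
  -- common ε, is a zero neighbourhood on which the glued functional is bounded by ε.
  refine mem_map.2 (mem_of_superset (hE.concat_nhds A hA _ hU) ?_)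
  rintro y ⟨x, hx, hy⟩
  refine hV _ (hA.ae_of_forall fun i => ?_)
  have hZ : indic P (A i) (hA.measurable i) * Z i y =
      indic P (A i) (hA.measurable i) * Z i (x i) := by
    rw [← smul_eq_mul, ← map_smul, hy i, map_smul, smul_eq_mul]
  filter_upwards [(indic_mul_eq_iff (hA.measurable i)).1 hZ, hf y i, hx i] with ω h1 h2 h3 hω
  change |(0 : L0 P) ω - f y ω| ≤ ε ω
  rw [h2 hω, h1 hω]; exact h3

/-- Normalises each coordinate neighbourhood so that one unit box serves for all coordinates. -/
theorem exists_scaled_ball {m : L0 P} {W : Set (L0 P)} (hW : W ∈ 𝓝 m) :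
    ∃ i : L0 P, Pos i ∧ ∀ z : L0 P, (∀ᵐ ω ∂P, |(i * (m - z)) ω| ≤ 1) → z ∈ W := by
  obtain ⟨ε, hε, h⟩ := mem_nhds_L0.1 hW
  obtain ⟨i, hi, h1⟩ := hε.exists_inv
  have h1' : ∀ᵐ ω ∂P, (i * ε) ω = 1 := h1 ▸ coe_one
  refine ⟨i, hi, fun z hz => h z ?_⟩
  filter_upwards [hz, hi, h1', coe_mul i ε, coe_mul i (m - z), coe_sub m z]
    with ω a1 a2 a3 a4 a5 a6
  rw [a5, a6, abs_mul, abs_of_pos a2, ← a3, a4] at a1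
  exact le_of_mul_le_mul_left a1 a2

/-- A point outside a cone of `K° × L⁰` that is closed for the weak topology is separated from it
by an element of `E × L⁰`. -/
theorem exists_predual_separation [IsFiniteMeasure P] {V : Set (polar P K × L0 P)}
    (hV : IsClosed[weakTopology K] V) {C : Set (Dual P E × L0 P)} (hC : IsL0Cone P C)
    (hCs : SigmaComplete P C)
    (hCV : ∀ p ∈ C, ∃ h : p.1 ∈ polar P K, ((⟨p.1, h⟩, p.2) : polar P K × L0 P) ∈ V)
    {p₀ : polar P K × L0 P} (hp₀ : p₀ ∉ V) :
    ∃ (x : E) (t : L0 P), (∀ p ∈ C, 0 ≤ p.1 x + t * p.2) ∧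
      ¬ 0 ≤ (p₀.1 : Dual P E) x + t * p₀.2 := by
  classical
  obtain ⟨O, hO, hOV⟩ := isOpen_induced_iff.1 (@IsClosed.isOpen_compl _ (weakTopology K) _ hV)
  have hmem : O ∈ 𝓝 (weakMap K p₀) := hO.mem_nhds (by
    change p₀ ∈ weakMap K ⁻¹' O
    rw [hOV]; exact hp₀)
  obtain ⟨O₁, h₁, O₂, h₂, hsub⟩ := mem_nhds_prod_iff.1 hmem
  rw [nhds_pi, Filter.mem_pi'] at h₁
  obtain ⟨I, t, ht, htI⟩ := h₁
  choose i _ hi using fun x => exists_scaled_ball (ht x)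
  obtain ⟨i₀, _, hi₀⟩ := exists_scaled_ball h₂
  -- A weak neighbourhood tests only finitely many points of E, so the problem descends along these
  -- rescaled evaluations to a finite free module; the extra index carries the scalar component.
  let T : Dual P E × L0 P →ₗ[L0 P] (Option I → L0 P) :=
    { toFun := fun p j => j.elim (i₀ * p.2) fun x => i x * p.1 x
      map_add' := fun p q => by
        funext j
        cases j with
        | none => exact mul_add _ _ _
        | some x => exact mul_add _ _ _
      map_smul' := fun c p => by
        funext j
        cases j with
        | none => exact mul_left_comm _ _ _
        | some x => exact mul_left_comm _ _ _ }
  obtain ⟨f, hf, -, hf₀⟩ := exists_separation (hC.image T) (hCs.image T)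
    (U := unitBox P (Option I)) l0Convex_unitBox l0Absorbent_unitBox l0Balanced_unitBox
    sigmaStable_unitBox (x₀ := T (p₀.1, p₀.2)) (by
      rintro _ ⟨p, hp, rfl⟩ hU
      obtain ⟨hpK, hpV⟩ := hCV p hp
      have hpO : ((⟨p.1, hpK⟩, p.2) : polar P K × L0 P) ∈ weakMap K ⁻¹' O := by
        refine hsub ⟨htI fun x hx => hi x _ ?_, hi₀ _ ?_⟩
        · have : (T (p₀.1, p₀.2) - T p) (some ⟨x, hx⟩) = i x * ((p₀.1 : Dual P E) x - p.1 x) :=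
            (mul_sub _ _ _).symm
          exact this ▸ hU (some ⟨x, hx⟩)
        · have : (T (p₀.1, p₀.2) - T p) none = i₀ * (p₀.2 - p.2) := (mul_sub _ _ _).symm
          exact this ▸ hU none
      rw [hOV] at hpO
      exact hpO hpV)
  -- A linear functional on a finite free module is given by its coefficients, and pulling it back
  -- along T yields evaluation at a point x plus a multiple of s.
  obtain ⟨x, t, hfT⟩ : ∃ (x : E) (t : L0 P), ∀ p, f (T p) = p.1 x + t * p.2 := by
    refine ⟨∑ x : I, (i x * f fun j => if some x = j then 1 else 0) • (x : E),
      i₀ * f fun j => if none = j then 1 else 0, fun p => ?_⟩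
    rw [LinearMap.pi_apply_eq_sum_univ f, Fintype.sum_option, map_sum, add_comm]
    congr 1
    · refine Finset.sum_congr rfl fun x _ => ?_
      rw [map_smul, smul_eq_mul, smul_eq_mul]
      change i x * p.1 x * _ = _
      ring
    · rw [smul_eq_mul]
      change i₀ * p.2 * _ = _
      ring
  exact ⟨x, t, fun p hp => hfT p ▸ hf _ ⟨p, hp, rfl⟩, fun h => hf₀ (hfT _ ▸ h)⟩

end WeakSeparation

/-! ### The sublevel sets of R⁻ as closed cones. -/

section Sublevel

variable {Ω : Type*} [MeasurableSpace Ω] {P : Measure Ω}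

theorem divE_toE {a i lam : L0 P} (h : i * lam = 1) : divE (toE a) lam = toE (i * a) := by
  have h' : ∀ᵐ ω ∂P, (i * lam) ω = 1 := h ▸ coe_one
  refine AEEqFun.ext ?_
  filter_upwards [coe_divE (toE a) lam, coe_toE a, coe_toE (i * a), coe_mul i a, h',
    coe_mul i lam] with ω h1 h2 h3 h4 h5 h6
  rw [h1, h2, h3, h4, eq_inv_of_mul_eq_one_left (h6.symm.trans h5), EReal.coe_mul]

theorem mix_toE (lam a b : L0 P) : mix lam (toE a) (toE b) = toE (lam * a + (1 - lam) * b) := by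
  refine AEEqFun.ext ?_
  filter_upwards [coe_mix lam (toE a) (toE b), coe_toE a, coe_toE b,
    coe_toE (lam * a + (1 - lam) * b), coe_add (lam * a) ((1 - lam) * b), coe_mul lam a,
    coe_mul (1 - lam) b, coe_sub 1 lam, coe_one (P := P)] with ω h1 h2 h3 h4 h5 h6 h7 h8 h9
  rw [h1, h2, h3, h4, h5, h6, h7, h8, h9]
  push_cast
  rfl

theorem UnitInterval.nonneg {lam : L0 P} (h : UnitInterval lam) : 0 ≤ lam ∧ 0 ≤ 1 - lam := by
  constructor <;> rw [le_iff]
  · filter_upwards [h, coe_zero (P := P)] with ω h1 h2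
    rw [h2]; exact h1.1
  · filter_upwards [h, coe_zero (P := P), coe_sub 1 lam, coe_one (P := P)] with ω h1 h2 h3 h4
    rw [h2, h3, h4]; exact sub_nonneg.2 h1.2

theorem exists_toE_between {a : L0 P} {n : EL0 P} (h : ∀ᵐ ω ∂P, (a ω : EReal) < n ω) :
    ∃ b : L0 P, toE b ≤ n ∧ ∀ᵐ ω ∂P, a ω < b ω := by
  -- The upper bound may be ∞, where a + 1 serves as a real value above a.
  have hm : Measurable fun ω => if n ω = ⊤ then a ω + 1 else (n ω).toReal :=
    Measurable.ite (n.measurable (measurableSet_singleton ⊤)) (a.measurable.add_const 1)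
      n.measurable.ereal_toReal
  refine ⟨AEEqFun.mk _ hm.aestronglyMeasurable, ?_, ?_⟩
  · rw [le_iff]
    filter_upwards [h, coe_mk (P := P) hm,
      coe_toE (AEEqFun.mk _ hm.aestronglyMeasurable : L0 P)] with ω h1 h2 h3
    rw [h3, h2]
    split_ifs with ht
    · rw [ht]; exact le_top
    · rw [EReal.coe_toReal ht (ne_bot_of_gt h1)]
  · filter_upwards [h, coe_mk (P := P) hm] with ω h1 h2
    rw [h2]
    split_ifs with ht
    · linarith
    · rwa [← EReal.coe_toReal ht (ne_bot_of_gt h1), EReal.coe_lt_coe_iff] at h1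

variable {E : Type*} [AddCommGroup E] [Module (L0 P) E] [TopologicalSpace E]

theorem dual_zero_smul (Z : Dual P E) : (0 : L0 P) • Z = 0 :=
  ContinuousLinearMap.ext fun x => zero_mul (Z x)

theorem dual_smul_zero (c : L0 P) : c • (0 : Dual P E) = 0 :=
  ContinuousLinearMap.ext fun _ => mul_zero c

theorem add_mem_polar {C : Set E} {X Y : Dual P E} (hX : X ∈ polar P C) (hY : Y ∈ polar P C) :
    X + Y ∈ polar P C := fun x hx => add_nonneg (hX x hx) (hY x hx)

theorem smul_mem_polar {C : Set E} {c : L0 P} (hc : 0 ≤ c) {X : Dual P E}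
    (hX : X ∈ polar P C) : c • X ∈ polar P C := fun x hx => mul_nonneg hc (hX x hx)

variable [IsFiniteMeasure P] {K : Set E} {R : polar P K → EL0 P → EL0 P}

/-- Joint locality applied to X = 1_A Y + 1_{Aᶜ} X: the value on A sees only the data on A. -/
theorem IsMinimalRiskFunction.congr_on (hR : IsMinimalRiskFunction R) {A : Set Ω}
    (hA : MeasurableSet A) {X Y : polar P K} {s t : EL0 P}
    (h : indic P A hA • (X : Dual P E) = indic P A hA • (Y : Dual P E))
    (hst : ∀ᵐ ω ∂P, ω ∈ A → s ω = t ω) : ∀ᵐ ω ∂P, ω ∈ A → R X s ω = R Y t ω := by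
  have h1 := hR.jointly_local A hA Y X X t s (by rw [← h]; exact eq_indic_add_compl A hA _)
  have h2 : glue A hA t s = s := AEEqFun.ext <| by
    filter_upwards [hst, coe_glue A hA t s] with ω h3 h4
    by_cases hω : ω ∈ A
    · rw [h4.1 hω, h3 hω]
    · rw [h4.2 hω]
  rw [h2] at h1
  filter_upwards [coe_glue A hA (R Y t) (R X s)] with ω h3 hω
  rw [← h3.1 hω, ← h1]

theorem IsMinimalRiskFunction.mono_on (hR : IsMinimalRiskFunction R) {A : Set Ω}
    (hA : MeasurableSet A) (Z : polar P K) {s t : EL0 P}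
    (hst : ∀ᵐ ω ∂P, ω ∈ A → s ω ≤ t ω) : ∀ᵐ ω ∂P, ω ∈ A → R Z s ω ≤ R Z t ω := by
  have hle : glue A hA s t ≤ t := le_iff.2 <| by
    filter_upwards [hst, coe_glue A hA s t] with ω h1 h2
    by_cases hω : ω ∈ A
    · rw [h2.1 hω]; exact h1 hω
    · rw [h2.2 hω]
  have heq := hR.congr_on (X := Z) (Y := Z) (s := s) (t := glue A hA s t) hA rfl (by
    filter_upwards [coe_glue A hA s t] with ω h1 hω
    rw [h1.1 hω])
  filter_upwards [heq, le_iff.1 (hR.increasing Z hle)] with ω h1 h2 hω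
  rw [h1 hω]; exact h2

/-- The sublevel set `{(Z, s) : R⁻(Z, s) ≤ m}`, as a subset of `E* × L⁰`. -/
def sublevel (R : polar P K → EL0 P → EL0 P) (m : EL0 P) : Set (Dual P E × L0 P) :=
  {p | ∃ h : p.1 ∈ polar P K, ∀ ε : L0 P, Pos ε → R ⟨p.1, h⟩ (toE (p.2 - ε)) ≤ m}

theorem IsMinimalRiskFunction.isClosed_sublevel (hR : IsMinimalRiskFunction R) (m : EL0 P) :
    IsClosed[weakTopology K]
      {p : polar P K × L0 P | ((p.1 : Dual P E), p.2) ∈ sublevel R m} := by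
  have heq : {p : polar P K × L0 P | ((p.1 : Dual P E), p.2) ∈ sublevel R m} =
      {p | leftVersion (R p.1) (toE p.2) ≤ m} := by
    ext p
    change _ ↔ leftVersion (R p.1) (toE p.2) ≤ m
    rw [leftVersion_le_iff (hR.increasing p.1)]
    exact ⟨fun h => h.2, fun h => ⟨p.1.2, h⟩⟩
  rw [heq]
  exact hR.left_lsc m

theorem IsMinimalRiskFunction.smul_mem_sublevel (hR : IsMinimalRiskFunction R) {m : EL0 P}
    {lam : L0 P} (hl : Pos lam) {p : Dual P E × L0 P} (hp : p ∈ sublevel R m) :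
    lam • p ∈ sublevel R m := by
  obtain ⟨hpK, hp⟩ := hp
  obtain ⟨i, hi, h1⟩ := hl.exists_inv
  refine ⟨smul_mem_polar hl.nonneg hpK, fun ε hε => ?_⟩
  rw [hR.scaling ⟨p.1, hpK⟩ ⟨(lam • p).1, _⟩ _ lam hl rfl, divE_toE h1]
  have h2 : i * ((lam • p).2 - ε) = p.2 - i * ε := by
    change i * (lam * p.2 - ε) = _
    rw [mul_sub, ← mul_assoc, h1, one_mul]
  rw [h2]
  exact hp _ (hi.mul hε)

/-- Convexity comes from joint quasiconvexity with the same ε in both arguments, homogeneity from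
the scaling rule. The origin is reached only as a limit along a ray, so the set must be closed and
nonempty. -/
theorem IsMinimalRiskFunction.isL0Cone_sublevel (hR : IsMinimalRiskFunction R) {m : EL0 P}
    (hne : (sublevel R m).Nonempty) : IsL0Cone P (sublevel R m) := by
  refine IsL0Cone.of_convex ?_ ?_ fun lam hl p hp => hR.smul_mem_sublevel hl hp
  · obtain ⟨p, hp⟩ := hne
    -- The ray is parametrised by c² so that the path stays in K° for every c in `L⁰`, not only for
    -- positive c.
    have hsq : ∀ c : L0 P, 0 ≤ c * c := fun c => le_iff.2 <| by
      filter_upwards [coe_mul c c, coe_zero (P := P)] with ω h1 h2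
      rw [h1, h2]; exact mul_self_nonneg _
    have hcont : Continuous[_, weakTopology K] fun c : L0 P =>
        ((⟨(c * c) • p.1, smul_mem_polar (hsq c) hp.1⟩, (c * c) * p.2) : polar P K × L0 P) := by
      rw [continuous_induced_rng]
      refine Continuous.prodMk (continuous_pi fun x => ?_) ?_
      · exact (continuous_id.mul continuous_id).mul continuous_const
      · exact (continuous_id.mul continuous_id).mul continuous_const
    have := @apply_zero_mem_of_isClosed _ _ P _ (weakTopology K) _ (hR.isClosed_sublevel m) _ hcont
      (fun c hc => hR.smul_mem_sublevel (hc.mul hc) hp)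
    change ((((0 : L0 P) * 0) • p.1, ((0 : L0 P) * 0) * p.2) : Dual P E × L0 P) ∈ sublevel R m
      at this
    rwa [mul_zero, dual_zero_smul, zero_mul] at this
  · rintro p ⟨hpK, hp⟩ q ⟨hqK, hq⟩ lam hl
    have hmem : (lam • p + (1 - lam) • q).1 ∈ polar P K :=
      add_mem_polar (smul_mem_polar hl.nonneg.1 hpK) (smul_mem_polar hl.nonneg.2 hqK)
    refine ⟨hmem, fun ε hε => ?_⟩
    have h := hR.jointly_quasiconvex ⟨p.1, hpK⟩ ⟨q.1, hqK⟩ ⟨_, hmem⟩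
      (toE (p.2 - ε)) (toE (q.2 - ε)) lam hl rfl
    rw [mix_toE] at h
    have he : lam * (p.2 - ε) + (1 - lam) * (q.2 - ε) = (lam • p + (1 - lam) • q).2 - ε := by
      change _ = lam * p.2 + (1 - lam) * q.2 - ε
      ring
    rw [he] at h
    exact h.trans (sup_le (hp ε hε) (hq ε hε))

theorem IsMinimalRiskFunction.sigmaComplete_sublevel (hR : IsMinimalRiskFunction R)
    (hE : IsStableLocallyConvex P E) (m : EL0 P) : SigmaComplete P (sublevel R m) := by
  intro A hA p hp
  choose hpK hp using hp
  obtain ⟨Y, hY⟩ := hE.exists_dual_concat hA fun i => (p i).1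
  obtain ⟨s, hs⟩ := exists_concat_L0 hA fun i => (p i).2
  have hYK : Y ∈ polar P K := fun x hx => le_iff.2 <| hA.ae_of_forall fun i => by
    filter_upwards [hY i x, le_iff.1 (hpK i x hx)] with ω h1 h2 hω
    rw [h1 hω]; exact h2
  have hYi : ∀ i, indic P (A i) (hA.measurable i) • Y =
      indic P (A i) (hA.measurable i) • (p i).1 := fun i =>
    ContinuousLinearMap.ext fun x => (indic_mul_eq_iff (hA.measurable i)).2 (hY i x)
  refine ⟨(Y, s), ⟨hYK, fun ε hε => le_iff.2 <| hA.ae_of_forall fun i => ?_⟩, fun i =>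
    Prod.ext (hYi i) ((indic_mul_eq_iff (hA.measurable i)).2 (hs i))⟩
  have := hR.congr_on (X := ⟨Y, hYK⟩) (Y := ⟨(p i).1, hpK i⟩) (s := toE (s - ε))
    (t := toE ((p i).2 - ε)) (hA.measurable i) (hYi i) (by
      filter_upwards [hs i, coe_toE (s - ε), coe_toE ((p i).2 - ε), coe_sub s ε,
        coe_sub (p i).2 ε] with ω h1 h2 h3 h4 h5 hω
      rw [h2, h3, h4, h5, h1 hω])
  filter_upwards [this, le_iff.1 (hp i ε hε)] with ω h1 h2 hω
  rw [h1 hω]; exact h2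

/-- By locality a bound valid only on B can be glued with the origin, which already belongs to the
sublevel set. -/
theorem IsMinimalRiskFunction.indic_smul_mem_sublevel (hR : IsMinimalRiskFunction R) {m : EL0 P}
    (h0 : (0 : Dual P E × L0 P) ∈ sublevel R m) {B : Set Ω} (hB : MeasurableSet B)
    (Z : polar P K) (s : L0 P)
    (h : ∀ ε : L0 P, Pos ε → ∀ᵐ ω ∂P, ω ∈ B → R Z (toE (s - ε)) ω ≤ m ω) :
    indic P B hB • ((Z : Dual P E), s) ∈ sublevel R m := by
  obtain ⟨h0K, h0⟩ := h0
  have hmem : indic P B hB • (Z : Dual P E) ∈ polar P K := smul_mem_polar (indic_nonneg B hB) Z.2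
  refine ⟨hmem, fun ε hε => ?_⟩
  have h1 := hR.congr_on (X := ⟨_, hmem⟩) (Y := Z) (s := toE (indic P B hB * s - ε))
    (t := toE (s - ε)) hB (by
      change indic P B hB • (indic P B hB • (Z : Dual P E)) = _
      rw [smul_smul, indic_mul_self]) (by
      filter_upwards [coe_toE (indic P B hB * s - ε), coe_toE (s - ε), coe_sub s ε,
        coe_sub (indic P B hB * s) ε, coe_mul (indic P B hB) s, coe_indic (P := P) B hB]
        with ω h1 h2 h3 h4 h5 h6 hω
      rw [h1, h2, h3, h4, h5, h6.1 hω, one_mul])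
  have h2 := hR.congr_on (X := ⟨_, hmem⟩) (Y := ⟨0, h0K⟩) (s := toE (indic P B hB * s - ε))
    (t := toE (0 - ε)) hB.compl (by
      change indic P Bᶜ hB.compl • (indic P B hB • (Z : Dual P E)) = _
      rw [smul_smul, mul_comm, indic_mul_compl]
      exact (dual_zero_smul _).trans (dual_smul_zero _).symm) (by
      filter_upwards [coe_toE (indic P B hB * s - ε), coe_toE (0 - ε), coe_sub 0 ε,
        coe_sub (indic P B hB * s) ε, coe_mul (indic P B hB) s, coe_indic (P := P) B hB,
        coe_zero (P := P)] with ω h1 h2 h3 h4 h5 h6 h7 hω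
      rw [h1, h2, h3, h4, h5, h6.2 hω, zero_mul, h7])
  rw [le_iff]
  filter_upwards [h1, h2, h ε hε, le_iff.1 (h0 ε hε)] with ω a1 a2 a3 a4
  by_cases hω : ω ∈ B
  · exact (a1 hω).le.trans (a3 hω)
  · exact (a2 hω).le.trans a4

end Sublevel

/-! ### Comparison of an arbitrary representing R with R_α. -/

section Uniqueness

variable {Ω : Type*} [MeasurableSpace Ω] {P : Measure Ω} [IsFiniteMeasure P]
  {E : Type*} [AddCommGroup E] [Module (L0 P) E] [TopologicalSpace E] {K : Set E}
  {R : polar P K → EL0 P → EL0 P} {α : E → EL0 P}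

theorem Represents.apply_le (hrep : Represents R α) (Z : polar P K) (x : E) :
    α x ≤ R Z (toE ((Z : Dual P E) x)) := by
  rw [hrep x]
  exact (isGLB_essinf _).1 (mem_range_self Z)

/-- Evaluating the representation at x = 0 gives R(Z, 0) ≥ α(0) = ∞; monotonicity does the rest. -/
theorem Represents.eq_top_of_nonneg (hrep : Represents R α) (hR : IsMinimalRiskFunction R)
    (h0 : ∀ᵐ ω ∂P, α 0 ω = ⊤) (Z : polar P K) (s : EL0 P) :
    ∀ᵐ ω ∂P, 0 ≤ s ω → R Z s ω = ⊤ := by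
  have hB : MeasurableSet {ω | 0 ≤ s ω} := measurableSet_le measurable_const s.measurable
  have h1 := hR.mono_on hB Z (s := toE 0) (t := s) (by
    filter_upwards [coe_toE (0 : L0 P), coe_zero (P := P)] with ω h1 h2 hω
    rw [h1, h2]; exact hω)
  have h2 := hrep.apply_le Z 0
  rw [map_zero] at h2
  filter_upwards [h1, le_iff.1 h2, h0] with ω a1 a2 a3 hω
  rw [a3] at a2
  exact top_le_iff.1 (a2.trans (a1 hω))

theorem Represents.apply_le_of_neg (hrep : Represents R α) (hR : IsMinimalRiskFunction R)
    (hscale : IsScaleInvariant α) (Z : polar P K) (y : E) (s : L0 P) :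
    ∀ᵐ ω ∂P, s ω < 0 → (Z : Dual P E) y ω < 0 → α y ω ≤ R Z (toE s) ω := by
  have hB : MeasurableSet {ω | s ω < 0 ∧ (Z : Dual P E) y ω < 0} :=
    (measurableSet_lt s.measurable measurable_const).inter
      (measurableSet_lt ((Z : Dual P E) y).measurable measurable_const)
  have hm : Measurable fun ω => s ω / (Z : Dual P E) y ω :=
    s.measurable.div ((Z : Dual P E) y).measurable
  -- The factor s/⟨Z, y⟩ is positive where both are negative and moves ⟨Z, y⟩ onto s, while α(λy) =
  -- α(y).
  obtain ⟨lam, hlam⟩ : ∃ lam : L0 P, lam = glue _ hB (AEEqFun.mk _ hm.aestronglyMeasurable) 1 :=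
    ⟨_, rfl⟩
  have hval : ∀ᵐ ω ∂P, (s ω < 0 ∧ (Z : Dual P E) y ω < 0 →
      lam ω = s ω / (Z : Dual P E) y ω) ∧
      (¬ (s ω < 0 ∧ (Z : Dual P E) y ω < 0) → lam ω = 1) := by
    rw [hlam]
    filter_upwards [coe_glue _ hB (AEEqFun.mk _ hm.aestronglyMeasurable) 1, coe_mk (P := P) hm,
      coe_one (P := P)] with ω h1 h2 h3
    exact ⟨fun h => (h1.1 h).trans h2, fun h => (h1.2 h).trans h3⟩
  have hpos : Pos lam := by
    filter_upwards [hval] with ω h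
    by_cases hω : s ω < 0 ∧ (Z : Dual P E) y ω < 0
    · rw [h.1 hω]; exact div_pos_of_neg_of_neg hω.1 hω.2
    · rw [h.2 hω]; exact one_pos
  have h1 := hrep.apply_le Z (lam • y)
  rw [hscale lam y hpos, map_smul, smul_eq_mul] at h1
  have h2 := hR.mono_on hB Z (s := toE (lam * (Z : Dual P E) y)) (t := toE s) (by
    filter_upwards [coe_toE (lam * (Z : Dual P E) y), coe_toE s, coe_mul lam ((Z : Dual P E) y),
      hval] with ω a1 a2 a3 a4 hω
    rw [a1, a2, a3, a4.1 hω, div_mul_cancel₀ _ hω.2.ne])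
  filter_upwards [le_iff.1 h1, h2] with ω a1 a2 h3 h4
  exact a1.trans (a2 ⟨h3, h4⟩)

/-- `scaleRisk` is the smallest risk function representing `α`. -/
theorem Represents.scaleRisk_le (hrep : Represents R α) (hR : IsMinimalRiskFunction R)
    (hα : IsAssessmentIndex K α) (hscale : IsScaleInvariant α) (h0 : ∀ᵐ ω ∂P, α 0 ω = ⊤)
    (Z : polar P K) (s : EL0 P) : scaleRisk K α Z s ≤ R Z s := by
  have key : ∀ᵐ ω ∂P, ω ∈ {ω | s ω < ⊤} → scaleRisk K α Z s ω ≤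
      essinf (R Z '' {n | ∀ᵐ ω ∂P, s ω < ⊤ → s ω < n ω}) ω := by
    refine (le_essinf_on (measurableSet_lt_top s)).2 ?_
    rintro _ ⟨n, hn, rfl⟩
    -- The comparison with α(y) needs real arguments. Passing by right-continuity to n > s ensures n
    -- > -∞, even where s = -∞.
    have hA : MeasurableSet {ω | ⊥ < n ω ∧ n ω < 0} :=
      (measurableSet_bot_lt n).inter (measurableSet_lt_zero n)
    have hm : Measurable fun ω => (n ω).toReal := n.measurable.ereal_toReal
    have hreal : ∀ᵐ ω ∂P, ω ∈ {ω | ⊥ < n ω ∧ n ω < 0} →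
        toE (AEEqFun.mk _ hm.aestronglyMeasurable : L0 P) ω = n ω := by
      filter_upwards [coe_toE (AEEqFun.mk _ hm.aestronglyMeasurable : L0 P),
        coe_mk (P := P) hm] with ω h1 h2 hω
      rw [h1, h2, EReal.coe_toReal (ne_top_of_lt hω.2) hω.1.ne']
    have hcrit : ∀ᵐ ω ∂P, ω ∈ {ω | ⊥ < n ω ∧ n ω < 0} →
        criticalLevel α (Z : Dual P E) ω ≤ R Z n ω :=
      (hα.criticalLevel_le_on h0 hA).2 fun y => by
        filter_upwards [hrep.apply_le_of_neg hR hscale Z y (AEEqFun.mk _ hm.aestronglyMeasurable),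
          hR.congr_on hA (X := Z) (Y := Z) rfl hreal, hreal,
          coe_toE (AEEqFun.mk _ hm.aestronglyMeasurable : L0 P)] with ω h1 h2 h3 h4 hω hneg
        rw [← h2 hω]
        refine h1 ?_ hneg
        have := hω.2
        rw [← h3 hω, h4] at this
        exact_mod_cast this
    filter_upwards [hn, hcrit, hrep.eq_top_of_nonneg hR h0 Z n, coe_scaleRisk α Z s]
      with ω h1 h2 h3 h4 hω
    by_cases hneg : n ω < 0
    · rw [h4.1 ((h1 hω).trans hneg)]
      exact h2 ⟨lt_of_le_of_lt bot_le (h1 hω), hneg⟩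
    · rw [h3 (not_lt.1 hneg)]; exact le_top
  rw [hR.rightContinuous Z s, le_iff]
  unfold rightVersion
  filter_upwards [key, coe_glue _ (measurableSet_lt_top s)
    (essinf (R Z '' {n | ∀ᵐ ω ∂P, s ω < ⊤ → s ω < n ω})) (AEEqFun.const Ω ⊤),
    coe_const (P := P) (⊤ : EReal)] with ω h1 h2 h3
  by_cases hω : ω ∈ {ω | s ω < ⊤}
  · rw [h2.1 hω]; exact h1 hω
  · rw [h2.2 hω, h3]; exact le_top

/-- Real arguments in the sublevel set are nonpositive where the level is finite. -/
theorem Represents.nonpos_of_mem_sublevel (hrep : Represents R α) (hR : IsMinimalRiskFunction R)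
    (h0 : ∀ᵐ ω ∂P, α 0 ω = ⊤) {m : EL0 P} {p : Dual P E × L0 P} (hp : p ∈ sublevel R m) :
    ∀ᵐ ω ∂P, m ω < ⊤ → p.2 ω ≤ 0 := by
  obtain ⟨hK, hp⟩ := hp
  have hB : MeasurableSet {ω | 0 < p.2 ω} := measurableSet_lt measurable_const p.2.measurable
  have hε : Pos (glue _ hB p.2 1) := by
    filter_upwards [coe_glue _ hB p.2 1, coe_one (P := P)] with ω h1 h2
    by_cases hω : ω ∈ {ω | 0 < p.2 ω}
    · rw [h1.1 hω]; exact hω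
    · rw [h1.2 hω, h2]; exact one_pos
  filter_upwards [le_iff.1 (hp _ hε), hrep.eq_top_of_nonneg hR h0 ⟨p.1, hK⟩
    (toE (p.2 - glue _ hB p.2 1)), coe_toE (p.2 - glue _ hB p.2 1),
    coe_sub p.2 (glue _ hB p.2 1), coe_glue _ hB p.2 1] with ω h1 h2 h3 h4 h5 hm
  by_contra hs
  rw [h2 (by rw [h3, h4, h5.1 (not_le.1 hs)]; simp)] at h1
  exact absurd hm (not_lt.2 h1)

/-- If `⟨Z, x⟩ ≥ s` on `{m < ∞}` for all `(Z, s)` in the sublevel set of `m`, then `α x ≥ m` on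
`{m < ∞}`. -/
theorem Represents.le_apply_of_sublevel (hrep : Represents R α) (hR : IsMinimalRiskFunction R)
    {m : EL0 P} (hzero : (0 : Dual P E × L0 P) ∈ sublevel R m) {x : E}
    (hx : ∀ p ∈ sublevel R m, ∀ᵐ ω ∂P, m ω < ⊤ → p.2 ω ≤ p.1 x ω) :
    ∀ᵐ ω ∂P, m ω < ⊤ → m ω ≤ α x ω := by
  rw [hrep x]
  refine (le_essinf_on (measurableSet_lt_top m)).2 ?_
  rintro _ ⟨Z, rfl⟩
  by_contra hcon
  have hB : MeasurableSet {ω | m ω < ⊤ ∧ R Z (toE ((Z : Dual P E) x)) ω < m ω} :=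
    (measurableSet_lt_top m).inter (measurableSet_lt (R Z _).measurable m.measurable)
  have hB0 : P {ω | m ω < ⊤ ∧ R Z (toE ((Z : Dual P E) x)) ω < m ω} ≠ 0 := fun h => hcon <| by
    rw [ae_iff]
    refine measure_mono_null (fun ω hω => ?_) h
    simpa using hω
  -- If R(Z, ⟨Z, x⟩) < m on a nonnegligible set, right-continuity leaves room for a real b > ⟨Z, x⟩
  -- with R(Z, b) ≤ m on a nonnegligible B. Then 1_B(Z, b) is in the sublevel set and violates the
  -- hypothesis on x.
  set S := R Z '' {n | ∀ᵐ ω ∂P, toE ((Z : Dual P E) x) ω < ⊤ → toE ((Z : Dual P E) x) ω < n ω}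
  have hlt : ∀ᵐ ω ∂P, ω ∈ {ω | m ω < ⊤ ∧ R Z (toE ((Z : Dual P E) x)) ω < m ω} →
      essinf S ω < m ω := by
    have h1 : ∀ᵐ ω ∂P, R Z (toE ((Z : Dual P E) x)) ω =
        rightVersion (R Z) (toE ((Z : Dual P E) x)) ω := by
      rw [← hR.rightContinuous]; exact Eventually.of_forall fun _ => rfl
    unfold rightVersion at h1
    filter_upwards [h1, coe_glue _ (measurableSet_lt_top (toE ((Z : Dual P E) x))) (essinf S)
      (AEEqFun.const Ω ⊤), coe_toE ((Z : Dual P E) x)] with ω h1 h2 h3 hω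
    have hmem : ω ∈ {ω | toE ((Z : Dual P E) x) ω < ⊤} := by
      change toE ((Z : Dual P E) x) ω < ⊤
      rw [h3]; exact EReal.coe_lt_top _
    rw [← h2.1 hmem, ← h1]
    exact hω.2
  obtain ⟨_, ⟨n, hn, rfl⟩, B, hBsub, hBm, hBpos, hBlt⟩ := exists_lt_of_essinf_lt hB hB0 hlt
  obtain ⟨b, hbn, hb⟩ := exists_toE_between (a := (Z : Dual P E) x) (n := n) (by
    filter_upwards [hn, coe_toE ((Z : Dual P E) x)] with ω h1 h2
    rw [h2] at h1
    exact h1 (EReal.coe_lt_top _))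
  have hmem := hR.indic_smul_mem_sublevel hzero hBm Z b fun ε hε => by
    have hle : toE (b - ε) ≤ n := le_trans (toE_le_toE.2 (sub_le_self b hε.nonneg)) hbn
    filter_upwards [le_iff.1 (hR.increasing Z hle)] with ω h1 hω
    exact h1.trans (hBlt ω hω).le
  refine hBpos (measure_mono_null ?_ (ae_iff.1 (((hx _ hmem).and hb).and
    ((coe_indic (P := P) B hBm).and ((coe_mul (indic P B hBm) b).and
      (coe_mul (indic P B hBm) ((Z : Dual P E) x)))))))
  rintro ω hω ⟨⟨h1, h2⟩, h3, h4, h5⟩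
  have h6 := h1 (hBsub hω).1
  change (indic P B hBm * b) ω ≤ (indic P B hBm * (Z : Dual P E) x) ω at h6
  rw [h4, h5, h3.1 hω, one_mul, one_mul] at h6
  exact absurd h2 (not_lt.2 h6)

/-- A risk function representing `α` is at most `m` at negative arguments if the critical level is
below `m`, provided that the sublevel set of `m` is nonempty. -/
theorem Represents.apply_le_of_criticalLevel_lt (hrep : Represents R α)
    (hR : IsMinimalRiskFunction R) (hE : IsStableLocallyConvex P E) (hα : IsAssessmentIndex K α)
    (h0 : ∀ᵐ ω ∂P, α 0 ω = ⊤) {m : EL0 P} (hne : (sublevel R m).Nonempty) (Z : polar P K)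
    (hcrit : ∀ᵐ ω ∂P, m ω < ⊤ → criticalLevel α (Z : Dual P E) ω < m ω) {s : L0 P}
    (hs : ∀ᵐ ω ∂P, s ω < 0) : R Z (toE s) ≤ m := by
  have hC := hR.isL0Cone_sublevel hne
  -- Half of s leaves a gap: R⁻(Z, s/2) ≤ m, tested with ε = -s/2 > 0, would give R(Z, s) ≤ m.
  have hm : Measurable fun ω => s ω / 2 := s.measurable.div_const 2
  obtain ⟨r, hr⟩ : ∃ r : L0 P, ∀ᵐ ω ∂P, r ω = s ω / 2 := ⟨_, coe_mk (P := P) hm⟩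
  by_contra hcon
  have hnot : (Z, r) ∉
      {p : polar P K × L0 P | ((p.1 : Dual P E), p.2) ∈ sublevel R m} := fun h => hcon <| by
    have h1 := h.2 (-r) (by
      filter_upwards [hr, hs, coe_neg r] with ω h1 h2 h3
      rw [h3, h1]; linarith)
    have h2 : r - -r = s := AEEqFun.ext <| by
      filter_upwards [hr, coe_neg r, coe_sub r (-r)] with ω h1 h2 h3
      rw [h3, h2, h1]; ring
    change R Z (toE (r - -r)) ≤ m at h1
    rwa [h2] at h1
  obtain ⟨x, t, hsep, hx⟩ := exists_predual_separation (hR.isClosed_sublevel m) hC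
    (hR.sigmaComplete_sublevel hE m) (fun p hp => ⟨hp.1, hp⟩) hnot
  -- The sublevel set is downward closed in s, so it contains (0, -1).
  have ht : t ≤ 0 := by
    have hmem : ((0, -1) : Dual P E × L0 P) ∈ sublevel R m := by
      obtain ⟨hK, h⟩ := hC.zero_mem
      refine ⟨hK, fun ε hε => (hR.increasing _ (toE_le_toE.2 ?_)).trans (h ε hε)⟩
      change -1 - ε ≤ 0 - ε
      exact sub_le_sub_right (neg_nonpos.2 pos_one.nonneg) ε
    have := hsep _ hmem
    change 0 ≤ (0 : L0 P) + t * -1 at this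
    rwa [zero_add, mul_neg, mul_one, neg_nonneg] at this
  have hpos : Pos (1 + -t) := pos_one.add_nonneg (neg_nonneg.2 ht)
  obtain ⟨i, hi, h1⟩ := hpos.exists_inv
  have h1' : ∀ᵐ ω ∂P, (i * (1 + -t)) ω = 1 := by rw [h1]; exact coe_one
  -- On {m < ∞} members (Y, u) have u ≤ 0, so ⟨Y, x⟩ ≥ -tu ≥ (1 - t)u. Dividing by 1 - t, which is
  -- positive even where t = 0, gives ⟨Y, x/(1 - t)⟩ ≥ u.
  have hle := hrep.le_apply_of_sublevel hR hC.zero_mem (x := i • x) fun p hp => by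
    rw [map_smul, smul_eq_mul]
    filter_upwards [hrep.nonpos_of_mem_sublevel hR h0 hp, le_iff.1 (hsep p hp), hi, h1',
      coe_mul i (1 + -t), coe_add 1 (-t), coe_neg t, coe_one (P := P), coe_mul i (p.1 x),
      coe_add (p.1 x) (t * p.2), coe_mul t p.2, coe_zero (P := P)]
      with ω a1 a2 a3 a4 a5 a6 a7 a8 a9 a10 a11 a12 hω
    rw [a5, a6, a7, a8] at a4
    rw [a10, a11, a12] at a2
    rw [a9]
    have h2 := mul_le_mul_of_nonneg_left
      (by linarith [a1 hω] : (1 + -t ω) * p.2 ω ≤ p.1 x ω) a3.le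
    rwa [← mul_assoc, a4, one_mul] at h2
  have hA : MeasurableSet {ω | ¬ m ω < ⊤} := (measurableSet_lt_top m).compl
  -- On {m = ∞} the bound by m is void, so the restriction of (Z, r) to that set lies in the cone
  -- and the separation cannot be strict there.
  have htop := hsep _ (hR.indic_smul_mem_sublevel hC.zero_mem hA Z r fun ε hε =>
    Eventually.of_forall fun ω hω => by
      rw [not_lt_top_iff.1 hω]; exact le_top)
  change 0 ≤ indic P _ hA * (Z : Dual P E) x + t * (indic P _ hA * r) at htop
  refine hx (le_iff.2 ?_)
  have hcl := hα.le_criticalLevel h0 Z (i • x)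
  rw [map_smul, smul_eq_mul] at hcl
  filter_upwards [hle, hcrit, hcl, hi, le_iff.1 htop, coe_zero (P := P), hr, hs, le_iff.1 ht,
    coe_indic (P := P) _ hA, coe_mul i ((Z : Dual P E) x),
    coe_add ((Z : Dual P E) x) (t * r), coe_mul t r,
    coe_add (indic P _ hA * (Z : Dual P E) x) (t * (indic P _ hA * r)),
    coe_mul (indic P _ hA) ((Z : Dual P E) x), coe_mul t (indic P _ hA * r),
    coe_mul (indic P _ hA) r]
    with ω a1 a2 a3 a4 a5 a6 a7 a8 a9 a10 a11 a12 a13 a14 a15 a16 a17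
  rw [a12, a13, a6]
  rw [a6] at a9
  by_cases hω : m ω < ⊤
  · have hZ : 0 ≤ (Z : Dual P E) x ω := by
      by_contra hneg
      have h2 : (i * (Z : Dual P E) x) ω < 0 := by
        rw [a11]; exact mul_neg_of_pos_of_neg a4 (not_le.1 hneg)
      exact absurd ((a1 hω).trans (a3 h2)) (not_le.2 (a2 hω))
    have := mul_nonneg_of_nonpos_of_nonpos a9 (by linarith : r ω ≤ 0)
    linarith
  · rw [a6, a14, a15, a16, a17, a10.1 hω, one_mul, one_mul] at a5
    exact a5

/-- Upper bound for an arbitrary risk function representing `α`. -/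
theorem Represents.le_scaleRisk (hrep : Represents R α) (hR : IsMinimalRiskFunction R)
    (hE : IsStableLocallyConvex P E) (hα : IsAssessmentIndex K α)
    (h0 : ∀ᵐ ω ∂P, α 0 ω = ⊤) (Z : polar P K) (s : EL0 P) (x : E) :
    ∀ᵐ ω ∂P, s ω < 0 → (Z : Dual P E) x ω ≠ 0 ∨ essinf (range α) ω = ⊥ →
      R Z s ω ≤ criticalLevel α (Z : Dual P E) ω := by
  -- Where ⟨Z, x⟩ ≠ 0, one of x and -x pairs negatively with Z, and its α-value lies between essinf
  -- α and the critical level.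
  have hinf : ∀ᵐ ω ∂P, (Z : Dual P E) x ω ≠ 0 →
      essinf (range α) ω ≤ criticalLevel α (Z : Dual P E) ω := by
    filter_upwards [hα.le_criticalLevel h0 Z x, hα.le_criticalLevel h0 Z (-x),
      le_iff.1 ((isGLB_essinf (range α)).1 (mem_range_self x)),
      le_iff.1 ((isGLB_essinf (range α)).1 (mem_range_self (-x))),
      (map_neg (Z : Dual P E) x) ▸ coe_neg ((Z : Dual P E) x)] with ω h1 h2 h3 h4 h5 hω
    rcases lt_or_gt_of_ne hω with h | h
    · exact h3.trans (h1 h)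
    · exact h4.trans (h2 (by rw [h5]; linarith))
  have key : ∀ᵐ ω ∂P, ∀ q r : ℚ, ¬ ((s ω < ((q : ℝ) : EReal) ∧ ((q : ℝ) : EReal) < 0) ∧
      (criticalLevel α (Z : Dual P E) ω < ((r : ℝ) : EReal) ∧
        essinf (range α) ω < ((r : ℝ) : EReal)) ∧ ((r : ℝ) : EReal) < R Z s ω) := by
    refine ae_all_iff.2 fun q => ae_all_iff.2 fun r => ?_
    by_contra hcon
    have e₁ : MeasurableSet {ω | s ω < ((q : ℝ) : EReal)} :=
      measurableSet_lt s.measurable measurable_const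
    have e₂ : MeasurableSet {ω | criticalLevel α (Z : Dual P E) ω < ((r : ℝ) : EReal)} :=
      measurableSet_lt (criticalLevel α (Z : Dual P E)).measurable measurable_const
    have e₃ : MeasurableSet {ω | essinf (range α) ω < ((r : ℝ) : EReal)} :=
      measurableSet_lt (essinf (range α)).measurable measurable_const
    have e₄ : MeasurableSet {ω | ((r : ℝ) : EReal) < R Z s ω} :=
      measurableSet_lt measurable_const (R Z s).measurable
    have hA : MeasurableSet {ω | (s ω < ((q : ℝ) : EReal) ∧ ((q : ℝ) : EReal) < 0) ∧
        (criticalLevel α (Z : Dual P E) ω < ((r : ℝ) : EReal) ∧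
          essinf (range α) ω < ((r : ℝ) : EReal)) ∧ ((r : ℝ) : EReal) < R Z s ω} :=
      (e₁.inter (MeasurableSet.const _)).inter ((e₂.inter e₃).inter e₄)
    set A := {ω | (s ω < ((q : ℝ) : EReal) ∧ ((q : ℝ) : EReal) < 0) ∧
        (criticalLevel α (Z : Dual P E) ω < ((r : ℝ) : EReal) ∧
          essinf (range α) ω < ((r : ℝ) : EReal)) ∧ ((r : ℝ) : EReal) < R Z s ω}
    have hA0 : P A ≠ 0 := fun h => hcon <| by
      rw [ae_iff]
      simpa only [not_not] using h
    have hconst : ∀ᵐ ω ∂P, (AEEqFun.const Ω ((r : ℝ) : EReal) : EL0 P) ω = ((r : ℝ) : EReal) :=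
      coe_const _
    -- Two selections yield a point of the sublevel set: first y with α(y) < r on part of A, then Y
    -- with R(Y, ⟨Y, y⟩) < r on a smaller part B.
    obtain ⟨_, ⟨y, rfl⟩, B₁, hB₁A, hB₁m, hB₁0, hB₁⟩ := exists_lt_of_essinf_lt hA hA0
      (S := range α) (m := AEEqFun.const Ω ((r : ℝ) : EReal)) (by
        filter_upwards [hconst] with ω h hω
        rw [h]; exact hω.2.1.2)
    obtain ⟨_, ⟨Y, rfl⟩, B, hBB, hBm, hB0, hB⟩ := exists_lt_of_essinf_lt hB₁m hB₁0
      (S := range fun Z : polar P K => R Z (toE ((Z : Dual P E) y)))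
      (m := AEEqFun.const Ω ((r : ℝ) : EReal)) (by
        rw [← hrep y]
        exact Eventually.of_forall hB₁)
    have hval : ∀ᵐ ω ∂P, (ω ∈ B → glue B hBm (AEEqFun.const Ω ((r : ℝ) : EReal))
        (AEEqFun.const Ω ⊤ : EL0 P) ω = ((r : ℝ) : EReal)) ∧
        (ω ∉ B → glue B hBm (AEEqFun.const Ω ((r : ℝ) : EReal))
        (AEEqFun.const Ω ⊤ : EL0 P) ω = ⊤) := by
      filter_upwards [coe_glue B hBm (AEEqFun.const Ω ((r : ℝ) : EReal))
        (AEEqFun.const Ω ⊤ : EL0 P), hconst, coe_const (P := P) (⊤ : EReal)] with ω h1 h2 h3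
      exact ⟨fun h => (h1.1 h).trans h2, fun h => (h1.2 h).trans h3⟩
    -- With level ∞ off B, both nonemptiness and the bound on the critical level have to hold only
    -- on B.
    set m : EL0 P := glue B hBm (AEEqFun.const Ω ((r : ℝ) : EReal)) (AEEqFun.const Ω ⊤)
    have hne : (sublevel R m).Nonempty := by
      refine ⟨((Y : Dual P E), (Y : Dual P E) y), Y.2, fun ε hε => ?_⟩
      refine (hR.increasing _ (toE_le_toE.2 (sub_le_self _ hε.nonneg))).trans ?_
      rw [le_iff]
      filter_upwards [hval, hconst] with ω h1 h2
      by_cases hω : ω ∈ B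
      · rw [h1.1 hω, ← h2]; exact (hB ω hω).le
      · rw [h1.2 hω]; exact le_top
    have hBA : B ⊆ A := hBB.trans hB₁A
    obtain ⟨ω₀, hω₀⟩ := nonempty_of_measure_ne_zero hB0
    have hq : (q : ℝ) < 0 := by exact_mod_cast (hBA hω₀).1.2
    have hle := hrep.apply_le_of_criticalLevel_lt hR hE hα h0 hne Z (by
      filter_upwards [hval] with ω h1 hω
      by_cases hωB : ω ∈ B
      · rw [h1.1 hωB]; exact (hBA hωB).2.1.1
      · rw [h1.2 hωB] at hω
        exact absurd hω (lt_irrefl _)) (s := AEEqFun.const Ω (q : ℝ)) (by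
      filter_upwards [coe_const (P := P) (q : ℝ)] with ω h1
      rw [h1]; exact hq)
    have hmono := hR.mono_on hBm Z (s := s) (t := toE (AEEqFun.const Ω (q : ℝ))) (by
      filter_upwards [coe_const (P := P) (q : ℝ), coe_toE (AEEqFun.const Ω (q : ℝ) : L0 P)]
        with ω h1 h2 hω
      rw [h2, h1]; exact (hBA hω).1.1.le)
    refine hB0 (measure_mono_null ?_ (ae_iff.1 ((hmono.and hval).and (le_iff.1 hle))))
    rintro ω hω ⟨⟨h1, h2⟩, h3⟩
    rw [h2.1 hω] at h3
    exact absurd (hBA hω).2.2 (not_lt.2 ((h1 hω).trans h3))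
  filter_upwards [key, hinf] with ω h1 h2 hs hω
  by_contra hlt
  rw [not_le] at hlt
  obtain ⟨q, hq1, hq2⟩ := EReal.exists_rat_btwn_of_lt hs
  obtain ⟨r, hr1, hr2⟩ := EReal.exists_rat_btwn_of_lt hlt
  refine h1 q r ⟨⟨hq1, hq2⟩, ⟨hr1, ?_⟩, hr2⟩
  rcases hω with h | h
  · exact (h2 h).trans_lt hr1
  · rw [h]; exact EReal.bot_lt_coe _

theorem Represents.eq_scaleRisk_on (hrep : Represents R α) (hR : IsMinimalRiskFunction R)
    (hE : IsStableLocallyConvex P E) (hα : IsAssessmentIndex K α)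
    (hscale : IsScaleInvariant α) (h0 : ∀ᵐ ω ∂P, α 0 ω = ⊤) (Z : polar P K) (s : EL0 P) (x : E) :
    ∀ᵐ ω ∂P, 0 ≤ s ω ∨ (Z : Dual P E) x ω ≠ 0 ∨ essinf (range α) ω = ⊥ →
      R Z s ω = scaleRisk K α Z s ω := by
  filter_upwards [hrep.le_scaleRisk hR hE hα h0 Z s x,
    le_iff.1 (hrep.scaleRisk_le hR hα hscale h0 Z s), coe_scaleRisk α Z s] with ω h1 h2 h3 hω
  refine le_antisymm ?_ h2
  by_cases hs : s ω < 0
  · rw [h3.1 hs]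
    exact h1 hs (hω.resolve_left (not_le.2 hs))
  · rw [h3.2 hs]; exact le_top

/-- On the set where R and R_α differ at (Z, s), every ⟨Z, x⟩ vanishes, so Z agrees with 0 there.
Locality transfers the value -∞ from Z = 0, and R ≥ R_α closes the gap. -/
theorem Represents.eq_scaleRisk (hrep : Represents R α) (hR : IsMinimalRiskFunction R)
    (hE : IsStableLocallyConvex P E) (hα : IsAssessmentIndex K α)
    (hscale : IsScaleInvariant α) (h0 : ∀ᵐ ω ∂P, α 0 ω = ⊤)
    (hbot : ∀ s : EL0 P, ∀ᵐ ω ∂P, s ω < 0 → R ⟨0, zero_mem_polar K⟩ s ω = ⊥) :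
    R = scaleRisk K α := by
  funext Z s
  have hD : MeasurableSet {ω | R Z s ω = scaleRisk K α Z s ω} :=
    measurableSet_eq_fun (R Z s).measurable (scaleRisk K α Z s).measurable
  have hZ : indic P _ hD.compl • (Z : Dual P E) = indic P _ hD.compl • (0 : Dual P E) :=
    ContinuousLinearMap.ext fun x =>
      (indic_mul_eq_iff hD.compl (a := (Z : Dual P E) x) (b := 0)).2 <| by
      filter_upwards [hrep.eq_scaleRisk_on hR hE hα hscale h0 Z s x, coe_zero (P := P)]
        with ω h1 h2 hω
      rw [h2]
      by_contra hne
      exact hω (h1 (Or.inr (Or.inl hne)))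
  refine le_antisymm (le_iff.2 ?_) (hrep.scaleRisk_le hR hα hscale h0 Z s)
  filter_upwards [hR.congr_on (X := Z) (Y := ⟨0, zero_mem_polar K⟩) (s := s) (t := s) hD.compl hZ
    (Eventually.of_forall fun _ _ => rfl), hbot s, coe_scaleRisk α Z s] with ω h1 h2 h3
  by_cases hω : R Z s ω = scaleRisk K α Z s ω
  · exact hω.le
  · by_cases hs : s ω < 0
    · rw [h1 hω, h2 hs]; exact bot_le
    · rw [h3.2 hs]; exact le_top

end Uniqueness

end L0Risk

theorem mainTheorem10 {Ω : Type*} [MeasurableSpace Ω] (P : Measure Ω) [IsProbabilityMeasure P]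
    {E : Type*} [AddCommGroup E] [Module (L0 P) E] [TopologicalSpace E]
    (hE : IsStableLocallyConvex P E)
    (K : Set E) (hK : IsClosedL0Cone P K)
    (α : E → EL0 P) (hα : IsAssessmentIndex K α) (husc : IsUSC α) (hscale : IsScaleInvariant α)
    (hne : ∀ m : L0 P, {x : E | toE m ≤ α x}.Nonempty) :
    IsMinimalRiskFunction (scaleRisk K α) ∧
    Represents (scaleRisk K α) α ∧
    (∀ R : polar P K → EL0 P → EL0 P, IsMinimalRiskFunction R → Represents R α →
      ∀ (Z : polar P K) (s : EL0 P) (x : E), ∀ᵐ ω ∂P,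
        0 ≤ s ω ∨ (Z : Dual P E) x ω ≠ 0 ∨ essinf (Set.range α) ω = ⊥ →
          R Z s ω = scaleRisk K α Z s ω) ∧
    (∀ R : polar P K → EL0 P → EL0 P, IsMinimalRiskFunction R → Represents R α →
      (∀ s : EL0 P, ∀ᵐ ω ∂P, s ω < 0 → R ⟨0, zero_mem_polar K⟩ s ω = ⊥) →
        R = scaleRisk K α) := by
  have h0 := apply_zero_eq_top hE husc hscale hne
  exact ⟨isMinimalRiskFunction_scaleRisk hα h0, represents_scaleRisk hE hα husc hscale h0,
    fun R hR hrep Z s x => hrep.eq_scaleRisk_on hR hE hα hscale h0 Z s x,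
    fun R hR hrep hbot => hrep.eq_scaleRisk hR hE hα hscale h0 hbot⟩
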